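/- For an oriented graph $G=(V_G,A_G)$ (a finite irreflexive, antisymmetric digraph) with underlying simple graph $U(G)$, an oriented $k$-colouring is a function $c:V_G\to\{1,\dots,k\}$ such that $c(u)\neq c(v)$ for every arc $uv\in A_G$, and such that for all arcs $uv,xy\in A_G$, if $c(u)=c(y)$ then $c(v)\neq c(x)$. Let $f_o(G,\lambda)$ be the unique polynomial such that $f_o(G,k)$ is the number of oriented $k$-colourings of $G$ for every natural number $k$, and let $f(\Gamma,\lambda)$ denote the chromatic polynomial of a finite simple graph $\Gamma$. Consider the following decision problems. CHROM-INVAR. Instance: a finite simple graph $\Gamma$. Question: is there an oriented graph $O$ with $U(O)=\Gamma$ such that $f_o(O,\lambda)=f(\Gamma,\lambda)$? OCHROM-INVAR. Instance: a finite oriented graph $G$. Question: does $f_o(G,\lambda)=f(U(G),\lambda)$ hold? Both decision problems are solvable in polynomial time: for each of them there are a deterministic (multi-stack) Turing machine and a polynomial $q$ such that the machine, started on the adjacency matrix of any instance (with vertex set $\{0,\dots,n-1\}$), halts with the correct yes/no answer after at most $q(\ell)$ steps, where $\ell$ is the length of the input. -/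

import Mathlib

open Polynomial

/-! ### Counting polynomials of relabelling-invariant families of colourings -/

/-- The maps `V → Fin k` with a property that is invariant under injective relabelling of the
colours are counted, for every `k`, by exactly one polynomial in `k`. -/
theorem existsUnique_countingPolynomial (V : Type) [Finite V]
    (good : ∀ k : ℕ, (V → Fin k) → Prop)
    (hgood : ∀ (k l : ℕ) (e : Fin k → Fin l), Function.Injective e →
      ∀ c : V → Fin k, good l (e ∘ c) ↔ good k c) :
    ∃! P : ℚ[X], ∀ k : ℕ, P.eval (k : ℚ) = (Nat.card {c : V → Fin k // good k c} : ℚ) := by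
  classical
  have := Fintype.ofFinite V
  let s : ℕ → ℕ := fun j => Nat.card {c : V → Fin j // good j c ∧ Function.Surjective c}
  have hs : ∀ j, Fintype.card V < j → s j = 0 := by
    intro j hj
    have : IsEmpty {c : V → Fin j // good j c ∧ Function.Surjective c} := by
      refine ⟨fun c => ?_⟩
      have := Fintype.card_le_of_surjective _ c.2.2
      simp at this
      omega
    exact Nat.card_of_isEmpty
  have hfib : ∀ (k : ℕ) (S : Finset (Fin k)),
      Nat.card {c : V → Fin k // good k c ∧ Finset.univ.image c = S} = s S.card := by
    intro k S
    let e : Fin S.card → Fin k := S.orderEmbOfFin rfl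
    have he : Function.Injective e := (S.orderEmbOfFin rfl).injective
    have her : Set.range e = S := S.range_orderEmbOfFin rfl
    symm
    refine Nat.card_congr (Equiv.ofBijective
      (fun c => ⟨e ∘ c.1, (hgood _ _ e he c.1).2 c.2.1, ?_⟩) ⟨?_, ?_⟩)
    · apply Finset.coe_injective
      rw [Finset.coe_image, Finset.coe_univ, Set.image_univ, Set.range_comp,
        c.2.2.range_eq, Set.image_univ, her]
    · intro c d h
      have h' : e ∘ c.1 = e ∘ d.1 := congrArg Subtype.val h
      exact Subtype.ext (he.comp_left h')
    · rintro ⟨c, hc, hcS⟩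
      have hmem : ∀ v, ∃ i, e i = c v := by
        intro v
        have : c v ∈ Set.range e := by
          rw [her, ← hcS]
          simp
        exact this
      choose d hd using hmem
      have hde : e ∘ d = c := funext hd
      refine ⟨⟨d, (hgood _ _ e he d).1 (hde ▸ hc), ?_⟩, Subtype.ext hde⟩
      intro i
      have : e i ∈ Finset.univ.image c := by
        rw [hcS, ← Finset.mem_coe, ← her]
        exact ⟨i, rfl⟩
      obtain ⟨v, -, hv⟩ := Finset.mem_image.1 this
      exact ⟨v, he (by rw [hd, hv])⟩
  have hcount : ∀ k : ℕ, Nat.card {c : V → Fin k // good k c}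
      = ∑ j ∈ Finset.range (Fintype.card V + 1), k.choose j * s j := by
    intro k
    have h1 : Nat.card {c : V → Fin k // good k c} = ∑ S : Finset (Fin k), s S.card := by
      have e1 : {c : V → Fin k // good k c} ≃
          Σ S : Finset (Fin k), {c : V → Fin k // good k c ∧ Finset.univ.image c = S} :=
        { toFun := fun c => ⟨Finset.univ.image c.1, c.1, c.2, rfl⟩
          invFun := fun x => ⟨x.2.1, x.2.2.1⟩
          left_inv := fun _ => rfl
          right_inv := by
            rintro ⟨S, c, hc, rfl⟩
            rfl }
      rw [Nat.card_congr e1, Nat.card_sigma]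
      exact Finset.sum_congr rfl fun S _ => hfib k S
    rw [h1, ← Finset.powerset_univ, Finset.sum_powerset_apply_card, Finset.card_univ,
      Fintype.card_fin]
    simp only [smul_eq_mul]
    have key : ∀ N M : ℕ, N ≤ M → (∀ j, N < j → k.choose j * s j = 0) →
        ∑ j ∈ Finset.range (N + 1), k.choose j * s j
          = ∑ j ∈ Finset.range (M + 1), k.choose j * s j := by
      intro N M hNM h
      refine Finset.sum_subset (Finset.range_mono (by omega)) fun j _ hj => h j ?_
      simp at hj
      omega
    rw [key k (max k (Fintype.card V)) (le_max_left _ _)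
        fun j hj => by rw [Nat.choose_eq_zero_of_lt hj, zero_mul],
      key (Fintype.card V) (max k (Fintype.card V)) (le_max_right _ _)
        fun j hj => by rw [hs j hj, mul_zero]]
  refine ⟨∑ j ∈ Finset.range (Fintype.card V + 1),
    C ((s j : ℚ) / (j.factorial : ℚ)) * descPochhammer ℚ j, ?_, ?_⟩
  · intro k
    rw [hcount k, eval_finsetSum]
    push_cast
    refine Finset.sum_congr rfl fun j _ => ?_
    rw [eval_mul, eval_C, descPochhammer_eval_eq_descFactorial,
      Nat.descFactorial_eq_factorial_mul_choose]
    have : (j.factorial : ℚ) ≠ 0 := by positivity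
    push_cast
    field_simp
  · intro Q hQ
    refine Polynomial.eq_of_infinite_eval_eq _ _ (Set.Infinite.mono ?_
      (Set.infinite_range_of_injective (Nat.cast_injective (R := ℚ))))
    rintro _ ⟨k, rfl⟩
    have := hQ k
    simp only [Set.mem_ofPred_eq]
    rw [this, hcount k, eval_finsetSum]
    push_cast
    refine Finset.sum_congr rfl fun j _ => ?_
    rw [eval_mul, eval_C, descPochhammer_eval_eq_descFactorial,
      Nat.descFactorial_eq_factorial_mul_choose]
    have : (j.factorial : ℚ) ≠ 0 := by positivity
    push_cast
    field_simp

/-! ### The chromatic polynomial of a graph -/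

theorem SimpleGraph.existsUnique_chromaticPolynomial {V : Type} [Finite V]
    (Γ : SimpleGraph V) :
    ∃! P : ℚ[X], ∀ k : ℕ, P.eval (k : ℚ) = (Nat.card (Γ.Coloring (Fin k)) : ℚ) := by
  have h := existsUnique_countingPolynomial V
    (fun k c => ∀ u v : V, Γ.Adj u v → c u ≠ c v)
    (fun k l e he c => by simp only [Function.comp_apply, he.ne_iff])
  have hcard : ∀ k : ℕ, Nat.card {c : V → Fin k // ∀ u v : V, Γ.Adj u v → c u ≠ c v}
      = Nat.card (Γ.Coloring (Fin k)) := fun k => Nat.card_congr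
    { toFun := fun c => SimpleGraph.Coloring.mk c.1 fun {u v} h => c.2 u v h
      invFun := fun c => ⟨c, fun _ _ h => c.valid h⟩
      left_inv := fun _ => rfl
      right_inv := fun _ => rfl }
  simpa only [hcard] using h

/-- The chromatic polynomial `f(Γ, λ)`: the unique polynomial whose value at every natural
number `k` is the number of proper colourings of `Γ` with colours `Fin k`. -/
noncomputable def SimpleGraph.chromaticPolynomial {V : Type} [Finite V]
    (Γ : SimpleGraph V) : ℚ[X] :=
  Γ.existsUnique_chromaticPolynomial.choose

/-! ### Oriented graphs and the oriented chromatic polynomial -/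

/-- An oriented graph: an irreflexive and antisymmetric digraph (no loops, and never both
of the arcs `uv` and `vu`). -/
structure OrientedGraph (V : Type) extends Digraph V where
  irrefl : ∀ u : V, ¬ Adj u u
  antisymm : ∀ u v : V, Adj u v → ¬ Adj v u

/-- The underlying simple graph `U(G)`. -/
def OrientedGraph.underlying {V : Type} (G : OrientedGraph V) : SimpleGraph V :=
  G.toDigraph.toSimpleGraphInclusive

/-- `c` is an oriented colouring of `G`. -/
def OrientedGraph.IsColoring {V : Type} (G : OrientedGraph V) {k : ℕ} (c : V → Fin k) : Prop :=
  (∀ u v : V, G.Adj u v → c u ≠ c v) ∧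
    ∀ u v x y : V, G.Adj u v → G.Adj x y → c u = c y → c v ≠ c x

theorem OrientedGraph.existsUnique_chromaticPolynomial {V : Type} [Finite V]
    (G : OrientedGraph V) :
    ∃! P : ℚ[X], ∀ k : ℕ, P.eval (k : ℚ) = (Nat.card {c : V → Fin k // G.IsColoring c} : ℚ) :=
  existsUnique_countingPolynomial V (fun _ c => G.IsColoring c)
    (fun k l e he c => by
      simp only [OrientedGraph.IsColoring, Function.comp_apply, he.ne_iff, he.eq_iff])

/-- The oriented chromatic polynomial `f_o(G, λ)`: the unique polynomial whose value at every
natural number `k` is the number of oriented colourings of `G` with colours `Fin k`. -/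
noncomputable def OrientedGraph.chromaticPolynomial {V : Type} [Finite V]
    (G : OrientedGraph V) : ℚ[X] :=
  G.existsUnique_chromaticPolynomial.choose

/-- `G` is chromatically invariant: `f_o(G, λ) = f(U(G), λ)`. -/
def OrientedGraph.ChromaticallyInvariant {V : Type} [Finite V] (G : OrientedGraph V) : Prop :=
  G.chromaticPolynomial = G.underlying.chromaticPolynomial

/-! ### Instances and their encoding by adjacency matrices -/

/-- An instance that is a finite graph, on the vertices `0, …, n - 1`. -/
abbrev GraphInstance : Type := Σ n : ℕ, SimpleGraph (Fin n)

/-- An instance that is a finite oriented graph, on the vertices `0, …, n - 1`. -/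
abbrev OrientedGraphInstance : Type := Σ n : ℕ, OrientedGraph (Fin n)

open Classical in
/-- The adjacency matrix of a relation on `Fin n`, written row by row over a three-letter
alphabet: `some b` is a matrix entry, `none` marks the end of a row. -/
noncomputable def encodeAdj (n : ℕ) (r : Fin n → Fin n → Prop) : List (Option Bool) :=
  (List.finRange n).flatMap fun i =>
    ((List.finRange n).map fun j => some (decide (r i j))) ++ [none]

theorem encodeAdj_length (n : ℕ) (r : Fin n → Fin n → Prop) :
    (encodeAdj n r).length = n * (n + 1) := by
  simp [encodeAdj, List.length_flatMap]

theorem encodeAdj_dim_injective {n m : ℕ} {r : Fin n → Fin n → Prop} {t : Fin m → Fin m → Prop}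
    (h : encodeAdj n r = encodeAdj m t) : n = m := by
  have h' := congrArg List.length h
  rw [encodeAdj_length, encodeAdj_length] at h'
  rcases lt_trichotomy n m with hlt | heq | hlt
  · nlinarith
  · exact heq
  · nlinarith

theorem encodeAdj_injective (n : ℕ) : Function.Injective (encodeAdj n) := by
  classical
  have key : ∀ {α β : Type} (l : List α) (f g : α → List β),
      (∀ i, (f i).length = (g i).length) → l.flatMap f = l.flatMap g → ∀ i ∈ l, f i = g i := by
    intro α β l f g hl
    induction l with
    | nil => simp
    | cons a l ih =>
      intro h
      rw [List.flatMap_cons, List.flatMap_cons] at h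
      obtain ⟨h1, h2⟩ := List.append_inj h (hl a)
      intro i hi
      rcases List.mem_cons.1 hi with rfl | hi
      · exact h1
      · exact ih h2 i hi
  intro r t h
  funext i j
  have hi := key _ _ _ (by simp) h i (List.mem_finRange i)
  have hj := List.map_inj_left.1 (List.append_cancel_right hi) j (List.mem_finRange j)
  simpa using hj

open Classical in
/-- The `Encoding` given by an injective encoding function. -/
noncomputable def encodingOfInjective {α Γ : Type} (f : α → List Γ)
    (hf : Function.Injective f) : Computability.Encoding α Γ where
  encode := f
  decode w := if h : ∃ a, f a = w then some h.choose else none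
  decode_encode a := by
    have h : ∃ b, f b = f a := ⟨a, rfl⟩
    rw [dif_pos h, hf h.choose_spec]

/-- Graphs are encoded by their adjacency matrices. -/
noncomputable def graphEncoding : Computability.Encoding GraphInstance (Option Bool) :=
  encodingOfInjective (fun x => encodeAdj x.1 x.2.Adj) (by
    rintro ⟨n, G⟩ ⟨m, H⟩ h
    obtain rfl := encodeAdj_dim_injective h
    have := encodeAdj_injective n h
    congr 1
    exact SimpleGraph.ext this)

/-- Oriented graphs are encoded by their adjacency matrices: the entry in row `u` and column
`v` says whether `uv` is an arc. -/
noncomputable def orientedGraphEncoding :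
    Computability.Encoding OrientedGraphInstance (Option Bool) :=
  encodingOfInjective (fun x => encodeAdj x.1 x.2.Adj) (by
    rintro ⟨n, ⟨G, hG1, hG2⟩⟩ ⟨m, ⟨H, hH1, hH2⟩⟩ h
    obtain rfl := encodeAdj_dim_injective h
    have h' := encodeAdj_injective n h
    obtain rfl : G = H := Digraph.ext h'
    rfl)

/-! ### Decision problems and polynomial time -/

open Classical in
/-- The decision problem `p` is solvable in polynomial time: some Turing machine, started on
the encoding of any instance `a`, halts with the correct answer (`true` if `p a`, `false`
otherwise) after at most `q (length of the encoding of a)` steps, for a fixed polynomial `q`. -/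
def SolvableInPolyTime {α Γ : Type} (e : Computability.Encoding α Γ) (p : α → Prop) : Prop :=
  Nonempty (Turing.TM2ComputableInPolyTime e.encode Computability.encodeBool
    (fun a => decide (p a)))

/-- CHROM-INVAR. Instance: a graph `Γ`. Question: is there an orientation `O` of `Γ` with
`f_o(O, λ) = f(Γ, λ)`? -/
def ChromInvar (x : GraphInstance) : Prop :=
  ∃ O : OrientedGraph (Fin x.1),
    O.underlying = x.2 ∧ O.chromaticPolynomial = x.2.chromaticPolynomial

/-- OCHROM-INVAR. Instance: an oriented graph `G`. Question: is `f_o(G, λ) = f(U(G), λ)`? -/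
def OChromInvar (x : OrientedGraphInstance) : Prop :=
  x.2.ChromaticallyInvariant

/-! ### Structured programs on stacks -/

/-! Every oriented colouring of `G` is a proper colouring of `U(G)`, so the two polynomials agree
exactly when, for every `k`, each proper `k`-colouring is oriented. This is a local condition on
pairs of arcs: for arcs `uv` and `xy`, either `u` and `y` or `v` and `x` are adjacent in `U(G)`. If
both pairs were nonadjacent, identifying `y` with `u` and `x` with `v` would give a proper colouring
that is not oriented; see `OrientedGraph.chromaticPolynomial_eq_iff_forall_adj`. OCHROM-INVAR is
thus decided by inspecting all quadruples of vertices.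

For CHROM-INVAR the condition reads as a system of implications: if `uv` and `yx` are arcs on edges
with `u, y` nonadjacent and `v, x` nonadjacent, then an invariant orientation containing `uv` must
contain `yx`. As for transitive orientations, the arcs split into implication classes, reversal
permutes the classes, and a suitable orientation exists if and only if no arc lies in the class of
its reversal (`SimpleGraph.exists_orientation_iff`). That is a reachability question on at most `n ^
2` arcs, settled by `n ^ 2` rounds of marking for each starting arc.

The machine model is reached in two compilations. Algorithms are written as nested loops over vertex
indices that read and write Boolean matrices (`LoopProg`), whose running time is visibly polynomial.
These become structured programs on stacks (`LoopProg.runs_compile`), with indices in unary and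
matrices stored row by row, and those become a multi-stack Turing machine with one machine step per
basic instruction (`StackProg.Runs.reaches`). `solvableInPolyTime_of_loopProg` packages the result,
so that only the two combinatorial algorithms remain to be verified. -/

/-- Structured programs acting on stacks indexed by `I` with symbols in `A`, with a register
in `τ`. -/
inductive StackProg (I A τ : Type) : Type
  | push (i : I) (f : τ → Option A) : StackProg I A τ
  | pop (i : I) (f : τ → Option A → τ) : StackProg I A τ
  | load (f : τ → τ) : StackProg I A τ
  | seq (p q : StackProg I A τ) : StackProg I A τ
  | loop (b : τ → Bool) (p : StackProg I A τ) : StackProg I A τ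

namespace StackProg

variable {I A τ : Type}

/-- `p.Runs v S v' S' t`: started with register `v` and stacks `S`, the program `p` ends with
register `v'` and stacks `S'` after at most `t` steps. -/
inductive Runs [DecidableEq I] :
    StackProg I A τ → τ → (I → List A) → τ → (I → List A) → ℕ → Prop
  | push (i f v S) : Runs (push i f) v S v (Function.update S i ((f v).toList ++ S i)) 1
  | pop (i f v S) : Runs (pop i f) v S (f v (S i).head?) (Function.update S i (S i).tail) 1
  | load (f v S) : Runs (load f) v S (f v) S 1
  | seq {p q v S v₁ S₁ v₂ S₂ a c} : Runs p v S v₁ S₁ a → Runs q v₁ S₁ v₂ S₂ c →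
      Runs (seq p q) v S v₂ S₂ (a + c)
  | loop_false {b v} (p S) : b v = false → Runs (loop b p) v S v S 1
  | loop_true {b p v S v₁ S₁ v₂ S₂ a c} : b v = true → Runs p v S v₁ S₁ a →
      Runs (loop b p) v₁ S₁ v₂ S₂ c → Runs (loop b p) v S v₂ S₂ (1 + (a + c))
  | mono {p v S v' S' t t'} : Runs p v S v' S' t → t ≤ t' → Runs p v S v' S' t'

/-- The labels of the Turing machine code of a program. -/
def Label : StackProg I A τ → Type
  | push _ _ => Unit
  | pop _ _ => Unit
  | load _ => Unit
  | seq p q => p.Label ⊕ q.Label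
  | loop _ p => Option p.Label

/-- There are finitely many labels. -/
@[reducible]
def labelFintype : (p : StackProg I A τ) → Fintype p.Label
  | push _ _ => inferInstanceAs (Fintype Unit)
  | pop _ _ => inferInstanceAs (Fintype Unit)
  | load _ => inferInstanceAs (Fintype Unit)
  | seq p q =>
    letI := labelFintype p
    letI := labelFintype q
    inferInstanceAs (Fintype (p.Label ⊕ q.Label))
  | loop _ p =>
    letI := labelFintype p
    inferInstanceAs (Fintype (Option p.Label))

/-- The label at which the execution of a program starts. -/
def entry : (p : StackProg I A τ) → p.Label
  | push _ _ => ()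
  | pop _ _ => ()
  | load _ => ()
  | seq p _ => Sum.inl p.entry
  | loop _ _ => none

/-- The alphabets of the stacks of the machine: the working stacks, and an output stack. -/
abbrev Alphabet (I A : Type) : Option I → Type
  | none => Bool
  | some _ => A

/-- The stacks of the machine when the output stack is empty. -/
def toStacks (S : I → List A) : (k : Option I) → List (Alphabet I A k)
  | none => []
  | some i => S i

theorem toStacks_update [DecidableEq I] (S : I → List A) (i : I) (l : List A) :
    Function.update (toStacks S) (some i) l = toStacks (Function.update S i l) := by
  funext k
  rcases k with _ | j
  · rfl
  · by_cases h : j = i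
    · subst h
      rw [Function.update_self]
      change l = Function.update S j l j
      rw [Function.update_self]
    · have h' : (some j : Option I) ≠ some i := by simpa using h
      rw [Function.update_of_ne h']
      change S j = Function.update S i l j
      rw [Function.update_of_ne h]

/-- The Turing machine code of a program, for an embedding `e` of its labels into the labels of
the machine, and the label `x` at which the execution continues. -/
def code [Inhabited A] {Λ : Type} :
    (p : StackProg I A τ) → (p.Label → Λ) → Λ → p.Label → Turing.TM2.Stmt (Alphabet I A) Λ τ
  | push i f, _, x, _ => .branch (fun v => (f v).isSome)
      (.push (some i) (fun v => ((f v).getD default : A)) (.goto fun _ => x)) (.goto fun _ => x)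
  | pop i f, _, x, _ => .pop (some i) f (.goto fun _ => x)
  | load f, _, x, _ => .load f (.goto fun _ => x)
  | seq p q, e, _, Sum.inl l => p.code (fun l => e (Sum.inl l)) (e (Sum.inr q.entry)) l
  | seq _ q, e, x, Sum.inr l => q.code (fun l => e (Sum.inr l)) x l
  | loop b p, e, x, none => .branch b (.goto fun _ => e (some p.entry)) (.goto fun _ => x)
  | loop _ p, e, _, some l => p.code (fun l => e (some l)) (e none) l

/-- Induction on the run. The embedding `e` and the exit `x` must be arbitrary because subprograms
are placed at different positions: the first part of a sequence exits to the entry of the second,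
and the body of a loop exits to the loop's own test. A basic instruction is a single machine step
because its statement ends in a jump. -/
theorem Runs.reaches [DecidableEq I] [Inhabited A] {Λ : Type}
    {M : Λ → Turing.TM2.Stmt (Alphabet I A) Λ τ} {p : StackProg I A τ} {v v' : τ}
    {S S' : I → List A} {t : ℕ} (hp : p.Runs v S v' S' t) :
    ∀ (e : p.Label → Λ) (x : Λ), (∀ l, M (e l) = p.code e x l) →
      ∃ k ≤ t, (flip bind (Turing.TM2.step M))^[k] (some ⟨some (e p.entry), v, toStacks S⟩)
        = some ⟨some x, v', toStacks S'⟩ := by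
  induction hp with
  | push i f v S =>
    intro e x h
    refine ⟨1, le_rfl, ?_⟩
    have h0 := h ()
    simp only [Function.iterate_one, flip, Option.bind_eq_bind, Option.bind_some,
      Turing.TM2.step.eq_2, entry, h0, code, Turing.TM2.stepAux.eq_5]
    rw [← toStacks_update]
    cases hf : f v with
    | none =>
      exact congrArg (fun T => some (Turing.TM2.Cfg.mk (some x) v T))
        (Function.update_eq_self (some i) (toStacks S)).symm
    | some a =>
      -- The machine's push needs a total function; the guard `isSome` ensures that the default
      -- symbol is never pushed.
      have ha : (f v).getD default = a := by rw [hf]; rfl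
      subst ha
      rfl
  | pop i f v S =>
    intro e x h
    refine ⟨1, le_rfl, ?_⟩
    have h0 := h ()
    simp only [Function.iterate_one, flip, Option.bind_eq_bind, Option.bind_some,
      Turing.TM2.step.eq_2, entry, h0, code]
    rw [← toStacks_update]
    rfl
  | load f v S =>
    intro e x h
    refine ⟨1, le_rfl, ?_⟩
    have h0 := h ()
    simp [flip, entry, h0, code]
  | seq _ _ ih₁ ih₂ =>
    intro e x h
    obtain ⟨k₁, hk₁, h₁⟩ := ih₁ _ _ fun l => h (Sum.inl l)
    obtain ⟨k₂, hk₂, h₂⟩ := ih₂ _ _ fun l => h (Sum.inr l)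
    refine ⟨k₂ + k₁, by omega, ?_⟩
    rw [Function.iterate_add_apply]
    exact (congrArg _ h₁).trans h₂
  | loop_false p S hb =>
    intro e x h
    refine ⟨1, le_rfl, ?_⟩
    have h0 := h none
    simp [flip, entry, h0, code, hb]
  | loop_true hb _ _ ih₁ ih₂ =>
    intro e x h
    obtain ⟨k₁, hk₁, h₁⟩ := ih₁ _ _ fun l => h (some l)
    obtain ⟨k₂, hk₂, h₂⟩ := ih₂ _ _ h
    -- The additional step evaluates the guard of the loop.
    refine ⟨k₂ + (k₁ + 1), by omega, ?_⟩
    rw [Function.iterate_add_apply, Function.iterate_add_apply]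
    have h0 := h none
    refine (congrArg _ (Eq.trans (congrArg _ ?_) h₁)).trans h₂
    simp [flip, entry, h0, code, hb]
  | mono _ hle ih =>
    intro e x h
    obtain ⟨k, hk, h'⟩ := ih e x h
    exact ⟨k, hk.trans hle, h'⟩

end StackProg

/-! ### Basic stack routines and their running times -/

namespace StackProg

section Macros

variable {I A σ : Type}

/-- Move the top symbol of stack `i` to the register. -/
def read (i : I) : StackProg I A (σ × Option A) := pop i fun v a => (v.1, a)

/-- Copy the symbol in the register to stack `i`. -/
def write (i : I) : StackProg I A (σ × Option A) := push i fun v => v.2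

/-- Push the symbol `a` on stack `i`. -/
def put (i : I) (a : A) : StackProg I A (σ × Option A) := push i fun _ => some a

/-- Move the symbols from stack `i` to stack `j`, starting with the one in the register, as long
as they satisfy `b`. -/
def moveWhile (b : Option A → Bool) (i j : I) : StackProg I A (σ × Option A) :=
  loop (fun v => b v.2) (seq (write j) (read i))

/-- Move all symbols from stack `i` to stack `j`. -/
def move (i j : I) : StackProg I A (σ × Option A) := seq (read i) (moveWhile Option.isSome i j)

/-- Pop the symbols of stack `i` one by one, executing `p` after each of them. -/
def drain (i : I) (p : StackProg I A (σ × Option A)) : StackProg I A (σ × Option A) :=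
  seq (read i) (loop (fun v => v.2.isSome) (seq p (read i)))

/-- Execute `p` as many times as there are symbols in stack `c`, which is restored afterwards;
`t` is an auxiliary stack and `a` is the symbol that is used for counting. -/
def repeatCount (c t : I) (a : A) (p : StackProg I A (σ × Option A)) :
    StackProg I A (σ × Option A) :=
  seq (drain c (seq (put t a) p)) (move t c)

/-- Execute `p i` for all `i` in the list `l`. -/
def forEach (l : List I) (p : I → StackProg I A σ) : StackProg I A σ :=
  l.foldr (fun i q => seq (p i) q) (load id)

/-- Push `f i a` on each stack `i`, where `a` is the symbol in the register. -/
noncomputable def distribute [Fintype I] (f : I → A → Option A) : StackProg I A (σ × Option A) :=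
  forEach (Finset.univ : Finset I).toList fun i => push i fun v => v.2.bind (f i)

/-- Empty all stacks. -/
noncomputable def clear [Fintype I] : StackProg I A (σ × Option A) :=
  forEach (Finset.univ : Finset I).toList fun i => drain i (load id)

variable [DecidableEq I]

theorem Runs.congr {p : StackProg I A σ} {v v' w' : σ} {S S' T' : I → List A} {t t' : ℕ}
    (h : p.Runs v S v' S' t) (hv : v' = w') (hS : S' = T') (ht : t ≤ t') :
    p.Runs v S w' T' t' := by
  subst hv hS
  exact h.mono ht

theorem Runs.congr_left {p : StackProg I A σ} {v w v' : σ} {S T S' : I → List A} {t : ℕ}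
    (h : p.Runs v S v' S' t) (hv : v = w) (hS : S = T) : p.Runs w T v' S' t := by
  subst hv hS
  exact h

theorem runs_read (i : I) (s : σ) (r : Option A) (S : I → List A) :
    (read i).Runs (s, r) S (s, (S i).head?) (Function.update S i (S i).tail) 1 :=
  Runs.pop i (fun v a => (v.1, a)) (s, r) S

theorem runs_write (i : I) (s : σ) (a : A) (S : I → List A) :
    (write i).Runs (s, some a) S (s, some a) (Function.update S i (a :: S i)) 1 :=
  Runs.push i (fun v : σ × Option A => v.2) (s, some a) S

theorem runs_put (i : I) (a : A) (v : σ × Option A) (S : I → List A) :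
    (put i a).Runs v S v (Function.update S i (a :: S i)) 1 :=
  Runs.push i (fun _ => some a) v S

/-- The guard can only inspect the register, so the next symbol is always popped in advance: hence
`head?` in the register and `tail` on the stack, before and after. Each symbol costs a test, a write
and a read; one more test ends the loop. -/
theorem runs_moveWhile {b : Option A → Bool} {i j : I} (hij : i ≠ j) (s : σ) {rest : List A}
    (hrest : b rest.head? = false) (L : List A) (hL : ∀ a ∈ L, b (some a) = true)
    (S : I → List A) :
    (moveWhile b i j).Runs (s, (L ++ rest).head?) (Function.update S i (L ++ rest).tail)
      (s, rest.head?) (Function.update (Function.update S j (L.reverse ++ S j)) i rest.tail)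
      (3 * L.length + 1) := by
  induction L generalizing S with
  | nil =>
    exact (Runs.loop_false (b := fun v : σ × Option A => b v.2) _ _ hrest).congr rfl
      (by simp) (by simp)
  | cons a L ih =>
    have h1 := runs_write j s a (Function.update S i (L ++ rest))
    have h2 := runs_read i s (some a)
      (Function.update (Function.update S i (L ++ rest)) j (a :: S j))
    have h3 := ih (fun c hc => hL c (List.mem_cons_of_mem _ hc)) (Function.update S j (a :: S j))
    rw [Function.update_of_ne hij.symm] at h1
    have e1 : Function.update (Function.update S i (L ++ rest)) j (a :: S j) i = L ++ rest := by
      rw [Function.update_of_ne hij, Function.update_self]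
    rw [e1, Function.update_comm hij, Function.update_idem] at h2
    rw [Function.update_comm hij] at h1
    refine (Runs.loop_true (b := fun v : σ × Option A => b v.2) (hL a (List.mem_cons_self ..))
      (h1.seq h2) h3).congr rfl ?_ ?_
    · simp
    · simp only [List.length_cons]
      omega

theorem runs_move {i j : I} (hij : i ≠ j) (s : σ) (r : Option A) (S : I → List A) :
    (move i j).Runs (s, r) S (s, none)
      (Function.update (Function.update S j ((S i).reverse ++ S j)) i [])
      (3 * (S i).length + 2) := by
  have h1 := runs_read i s r S
  have h2 := runs_moveWhile (b := Option.isSome) hij s (rest := []) rfl (S i) (by simp) S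
  rw [List.append_nil] at h2
  exact (h1.seq h2).congr rfl rfl (by omega)

/-- The index `k` of `st` and `mem` is the number of symbols still on the counter stack, so it runs
downwards from `m` to `0`. Besides the body, an iteration costs a test and a pop; the summand `2` is
the initial pop and the final test. -/
theorem runs_drain {i : I} {a : A} {c : ℕ} {p : StackProg I A (σ × Option A)} (st : ℕ → σ)
    (mem : ℕ → I → List A) (r : Option A) (m : ℕ)
    (hmem : ∀ k ≤ m, mem k i = List.replicate k a)
    (hp : ∀ k < m, ∃ r', p.Runs (st (k + 1), some a)
      (Function.update (mem (k + 1)) i (List.replicate k a)) (st k, r') (mem k) c) :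
    (drain i p).Runs (st m, r) (mem m) (st 0, none) (mem 0) ((c + 2) * m + 2) := by
  have key : ∀ k ≤ m, (loop (fun v => v.2.isSome) (seq p (read i))).Runs
      (st k, (List.replicate k a).head?) (Function.update (mem k) i (List.replicate k a).tail)
      (st 0, none) (mem 0) ((c + 2) * k + 1) := by
    intro k hk
    induction k with
    | zero =>
      refine (Runs.loop_false _ _ rfl).congr rfl ?_ (by simp)
      have := hmem 0 hk
      simp only [List.replicate_zero] at this
      rw [List.replicate_zero, List.tail_nil, ← this, Function.update_eq_self]
    | succ k ih =>
      obtain ⟨r', h1⟩ := hp k hk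
      have h2 := runs_read i (st k) r' (mem k)
      rw [hmem k (by omega)] at h2
      refine (Runs.loop_true rfl (h1.seq h2) (ih (by omega))).congr rfl rfl ?_
      rw [Nat.mul_succ]
      omega
  have h1 := runs_read i (st m) r (mem m)
  rw [hmem m le_rfl] at h1
  exact (h1.seq (key m le_rfl)).congr rfl rfl (by omega)

/-- Stack `i` starts with the blocks `B`, and each execution of `p` carries one block over to `j`,
reversing it. The counter symbols are collected on `t` and moved back at the end, which adds three
steps per block. -/
theorem runs_repeatCount {i j c t : I} (hic : i ≠ c) (hit : i ≠ t) (hij : i ≠ j) (hjc : j ≠ c)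
    (hjt : j ≠ t) (hct : c ≠ t) {a : A} {p : StackProg I A (σ × Option A)} {s : σ} {d : ℕ}
    (rest : List A) (B : List (List A))
    (hp : ∀ b ∈ B, ∀ r S rest', S i = b ++ rest' → ∃ r', p.Runs (s, r) S (s, r')
      (Function.update (Function.update S j (b.reverse ++ S j)) i rest') d)
    (r : Option A) (S : I → List A) (hSc : S c = List.replicate B.length a) (hSt : S t = [])
    (hSi : S i = B.flatten ++ rest) :
    (repeatCount c t a p).Runs (s, r) S (s, none)
      (Function.update (Function.update S j (B.flatten.reverse ++ S j)) i rest)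
      ((d + 6) * B.length + 4) := by
  have key : ∀ S : I → List A, S i = B.flatten ++ rest →
      (loop (fun v => v.2.isSome) (seq (seq (put t a) p) (read c))).Runs
      (s, (List.replicate B.length a).head?)
      (Function.update S c (List.replicate B.length a).tail) (s, none)
      (Function.update (Function.update (Function.update (Function.update S t
        (List.replicate B.length a ++ S t)) c []) j (B.flatten.reverse ++ S j)) i rest)
      ((d + 3) * B.length + 1) := by
    -- These hypotheses concern the original `S` and the full list `B`; the induction needs neither.
    clear hSc hSt hSi
    induction B with
    | nil =>
      intro S hSi
      refine (Runs.loop_false _ _ rfl).congr rfl ?_ (by simp)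
      funext k
      simp only [Function.update_apply]
      split_ifs <;> simp_all
    | cons b B ih =>
      intro S hSi
      have h1 := runs_put t a (s, some a) (Function.update S c (List.replicate B.length a))
      obtain ⟨r', h2⟩ := hp b (List.mem_cons_self ..) (some a) (Function.update
        (Function.update S c (List.replicate B.length a)) t
        (a :: Function.update S c (List.replicate B.length a) t)) (B.flatten ++ rest) (by
          simp [Function.update_of_ne, hic, hit, hSi])
      have h3 := fun S => runs_read (A := A) c s r' S
      have h4 := ih (fun b' hb' => hp b' (List.mem_cons_of_mem _ hb'))
        (Function.update (Function.update (Function.update S t (a :: S t)) j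
          (b.reverse ++ S j)) i (B.flatten ++ rest)) (by simp)
      refine (Runs.loop_true rfl ((h1.seq h2).seq (h3 _))
        (h4.congr_left ?_ ?_)).congr rfl ?_ ?_
      · simp [Function.update_of_ne, hic.symm, hjc.symm, hct]
      · funext k
        simp only [Function.update_apply]
        split_ifs <;> simp_all
      · funext k
        simp only [Function.update_apply]
        split_ifs <;> simp_all [List.replicate_succ']
      · simp only [List.length_cons, Nat.mul_succ]
        omega
  have h1 := runs_read c s r S
  have h2 := key S hSi
  rw [hSc] at h1
  have h3 := runs_move hct.symm s none (Function.update (Function.update (Function.update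
    (Function.update S t (List.replicate B.length a ++ S t)) c []) j
      (B.flatten.reverse ++ S j)) i rest)
  refine ((h1.seq h2).seq h3).congr rfl ?_ ?_
  · funext k
    simp only [Function.update_apply]
    split_ifs <;> simp_all
  · simp [Function.update_of_ne, hit.symm, hjt.symm, hct.symm, hSt]
    ring_nf
    omega

/-- Since `p i` changes only stack `i` and the list has no duplicates, each stack still has its
original contents when its turn comes. The inner claim therefore allows any memory `T` that agrees
with `S` on the remaining list. -/
theorem runs_forEach {p : I → StackProg I A σ} {c : ℕ} {v : σ} (upd : I → List A → List A)
    (l : List I) (hl : l.Nodup) (S : I → List A)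
    (hp : ∀ i S', S' i = S i → (p i).Runs v S' v (Function.update S' i (upd i (S i))) c) :
    (forEach l p).Runs v S v (fun i => if i ∈ l then upd i (S i) else S i)
      (c * l.length + 1) := by
  have key : ∀ (T : I → List A), (∀ i ∈ l, T i = S i) → (forEach l p).Runs v T v
      (fun i => if i ∈ l then upd i (S i) else T i) (c * l.length + 1) := by
    induction l with
    | nil => exact fun T _ => (Runs.load id v T).congr rfl (by simp) (by simp)
    | cons i l ih =>
      intro T hT
      obtain ⟨hi, hl⟩ := List.nodup_cons.1 hl
      refine ((hp i T (hT i (List.mem_cons_self ..))).seq (ih hl _ fun k hk => ?_)).congr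
        rfl ?_ ?_
      · rw [Function.update_of_ne (ne_of_mem_of_not_mem hk hi), hT k (List.mem_cons_of_mem _ hk)]
      · funext k
        by_cases hk : k = i
        · subst hk
          simp [hi]
        · simp [hk]
      · simp only [List.length_cons, Nat.mul_succ]
        omega
  exact key S fun _ _ => rfl

theorem runs_distribute [Fintype I] (f : I → A → Option A) (s : σ) (a : A) (S : I → List A) :
    (distribute f).Runs (s, some a) S (s, some a) (fun i => (f i a).toList ++ S i)
      (Fintype.card I + 1) := by
  refine (runs_forEach (c := 1) (fun i l => (f i a).toList ++ l) (Finset.univ : Finset I).toList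
    (Finset.nodup_toList _) S fun i S' hi => ?_).congr rfl (by simp) (by simp)
  rw [← hi]
  exact Runs.push i (fun v : σ × Option A => v.2.bind (f i)) (s, some a) S'

/-- Here the drained stack has arbitrary contents, whereas `runs_drain` is for unary counters. -/
theorem runs_drain_load_id {i : I} (s : σ) (r : Option A) (S : I → List A) :
    (drain i (load id)).Runs (s, r) S (s, none) (Function.update S i [])
      (3 * (S i).length + 2) := by
  have key : ∀ L : List A, (loop (fun v => v.2.isSome) (seq (load id) (read i))).Runs
      (s, L.head?) (Function.update S i L.tail) (s, none) (Function.update S i [])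
      (3 * L.length + 1) := by
    intro L
    induction L with
    | nil => exact Runs.loop_false _ _ rfl
    | cons a L ih =>
      have h1 := runs_read i s (some a) (Function.update S i L)
      rw [Function.update_self, Function.update_idem] at h1
      refine (Runs.loop_true rfl ((Runs.load id (s, some a) _).seq h1) ih).congr rfl rfl ?_
      simp only [List.length_cons]
      omega
  exact ((runs_read i s r S).seq (key (S i))).congr rfl rfl (by omega)

theorem runs_clear [Fintype I] (s : σ) (S : I → List A) (m : ℕ) (hm : ∀ i, (S i).length ≤ m) :
    clear.Runs (s, none) S (s, none) (fun _ => []) ((3 * m + 2) * Fintype.card I + 1) := by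
  refine (runs_forEach (c := 3 * m + 2) (fun _ _ => []) (Finset.univ : Finset I).toList
    (Finset.nodup_toList _) S fun i S' hi => ?_).congr rfl (by simp) (by simp)
  refine (runs_drain_load_id s none S').mono ?_
  have := hm i
  rw [hi]
  omega

/-- Popping and pushing reverses the order of the symbols. The hypothesis `hf` keeps the drained
stack from being refilled. -/
theorem runs_drain_distribute [Fintype I] {i : I} {f : I → A → Option A}
    (hf : ∀ a, f i a = none) (s : σ) (r : Option A) (S : I → List A) :
    (drain i (distribute f)).Runs (s, r) S (s, none)
      (Function.update (fun k => (S i).reverse.filterMap (f k) ++ S k) i [])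
      ((Fintype.card I + 3) * (S i).length + 2) := by
  have key : ∀ (L : List A) (S : I → List A),
      (loop (fun v => v.2.isSome) (seq (distribute f) (read i))).Runs
      (s, L.head?) (Function.update S i L.tail) (s, none)
      (Function.update (fun k => L.reverse.filterMap (f k) ++ S k) i [])
      ((Fintype.card I + 3) * L.length + 1) := by
    intro L
    induction L with
    | nil => exact fun S => (Runs.loop_false _ _ rfl).congr rfl (by simp) (by simp)
    | cons a L ih =>
      intro S
      have h1 := runs_distribute f s a (Function.update S i L)
      have h2 := runs_read i s (some a) (fun k => (f k a).toList ++ Function.update S i L k)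
      have h3 := ih (fun k => (f k a).toList ++ S k)
      refine (Runs.loop_true rfl (h1.seq h2)
        (h3.congr_left ?_ ?_)).congr rfl ?_ ?_
      · simp [hf]
      · funext k
        simp only [Function.update_apply]
        split_ifs <;> simp_all
      · funext k
        by_cases hk : k = i
        · subst hk
          simp
        · cases h : f k a <;> simp [hk, h]
      · simp only [List.length_cons, Nat.mul_succ]
        omega
  exact ((runs_read i s r S).seq (key (S i) S)).congr rfl rfl (by omega)

end Macros
end StackProg

/-! ### Loop programs on Boolean matrices -/

/-- Programs acting on Boolean matrices named by `R`, with index variables `V` and a register in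
`σ`: an access to an entry of a matrix, which reads and overwrites the entry and updates the
register; sequential composition; and a loop over all values of an index variable. -/
inductive LoopProg (R V σ : Type) : Type
  | access (r : R) (x y : V) (f : σ → Bool → σ × Bool) : LoopProg R V σ
  | seq (p q : LoopProg R V σ) : LoopProg R V σ
  | forAll (x : V) (p : LoopProg R V σ) : LoopProg R V σ

namespace LoopProg

variable {R V σ : Type} [DecidableEq R] [DecidableEq V]

/-- The result of executing a program on `n × n` matrices. -/
def eval (n : ℕ) : LoopProg R V σ → (V → ℕ) → σ × (R → ℕ → ℕ → Bool) → σ × (R → ℕ → ℕ → Bool)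
  | access r x y f, e, v =>
    ((f v.1 (v.2 r (e x) (e y))).1, Function.update v.2 r (Function.update (v.2 r) (e x)
      (Function.update (v.2 r (e x)) (e y) (f v.1 (v.2 r (e x) (e y))).2)))
  | seq p q, e, v => q.eval n e (p.eval n e v)
  | forAll x p, e, v => (List.range n).foldl (fun v i => p.eval n (Function.update e x i) v) v

/-- Matrices are accessed only at variables that are in the scope of a loop or in `D`, and no
loop reuses such a variable. -/
def Scoped : LoopProg R V σ → Finset V → Prop
  | access _ x y _, D => x ∈ D ∧ y ∈ D
  | seq p q, D => p.Scoped D ∧ q.Scoped D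
  | forAll x p, D => x ∉ D ∧ p.Scoped (insert x D)

/-- A bound for the running time in terms of the size of the matrices. -/
noncomputable def cost : LoopProg R V σ → ℕ[X]
  | access _ _ _ _ => 20 * (X + 1) ^ 2
  | seq p q => p.cost + q.cost
  -- Per iteration: 3 steps of counter bookkeeping, 2 steps for draining, and 3 to move the counter
  -- symbol back at the end. The constant 4 comes from the start and end of the drain and of the
  -- move.
  | forAll _ p => X * (p.cost + 8) + 4

/-- The stacks that are used for the execution of a loop program. -/
inductive Stk (R V : Type) : Type
  | rel (r : R) : Stk R V
  | lo (x : V) : Stk R V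
  | hi (x : V) : Stk R V
  | buf : Stk R V
  | tmp : Stk R V
  deriving DecidableEq, Fintype

open StackProg

/-- The adjacency matrix code of a Boolean matrix. -/
def encodeMatrix (n : ℕ) (m : ℕ → ℕ → Bool) : List (Option Bool) :=
  (List.range n).flatMap fun i => (List.range n).map (fun j => some (m i j)) ++ [none]

/-- The contents of the stacks when the variables have the values `e` and the matrices are `M`. -/
def memory (n : ℕ) (e : V → ℕ) (M : R → ℕ → ℕ → Bool) : Stk R V → List (Option Bool)
  | .rel r => encodeMatrix n (M r)
  | .lo x => List.replicate (e x) none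
  | .hi x => List.replicate (n - e x) none
  | .buf => []
  | .tmp => []

/-- Move a row of a matrix from stack `i` to stack `j`. -/
def skipRow {I : Type} (i j : I) : StackProg I (Option Bool) (σ × Option (Option Bool)) :=
  .seq (read i) (.seq (moveWhile (fun a => a != some none) i j) (put j none))

/-- Execution of a loop program on stacks. -/
def compile : LoopProg R V σ → StackProg (Stk R V) (Option Bool) (σ × Option (Option Bool))
  | access r x y f =>
    -- The entry is brought to the top of its stack by moving `e x` rows and then `e y` entries to
    -- the buffer, which is poured back after the update.
    .seq (repeatCount (.lo x) .tmp none (skipRow (.rel r) .buf)) <|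
    .seq (repeatCount (.lo y) .tmp none (.seq (read (.rel r)) (write .buf))) <|
    -- In a run on valid indices the popped symbol is a matrix entry, so the value `false` for an
    -- empty stack or a row end is not used.
    .seq (.pop (.rel r) fun v a => ((f v.1 (a.join.getD false)).1,
      some (some (f v.1 (a.join.getD false)).2))) <|
    .seq (write (.rel r)) (move .buf (.rel r))
  | seq p q => .seq p.compile q.compile
  | forAll x p =>
    -- The popped symbol is put back on `hi x` while the body runs, so that the two stacks of `x`
    -- together hold `n` symbols; then it goes to `lo x`. The final move resets `x` to `0`.
    .seq (drain (.hi x) <| .seq (put (.hi x) none) <| .seq p.compile <|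
      .seq (read (.hi x)) (put (.lo x) none)) (move (.lo x) (.hi x))

theorem range_eq_append_cons {a n : ℕ} (h : a < n) :
    List.range n = List.range a ++ a :: List.range' (a + 1) (n - a - 1) := by
  obtain ⟨k, rfl⟩ : ∃ k, n = a + (k + 1) := ⟨n - a - 1, by omega⟩
  rw [List.range_eq_range', List.range_eq_range', ← List.range'_append_1, List.range'_succ]
  simp

/-- The surrounding data `B`, `C`, `T` are chosen before `z`, so a single decomposition describes
the encoding both before and after the entry is overwritten. -/
theorem encodeMatrix_eq_append (n : ℕ) (m : ℕ → ℕ → Bool) {a b : ℕ} (ha : a < n) (hb : b < n) :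
    ∃ (B : List (List Bool)) (C : List Bool) (T : List (Option Bool)),
      B.length = a ∧ C.length = b ∧ (∀ w ∈ B, w.length = n) ∧
      ∀ z, encodeMatrix n (Function.update m a (Function.update (m a) b z)) =
        (B.map fun w => w.map some ++ [none]).flatten ++
          ((C.map fun c => [some c]).flatten ++ (some z :: T)) := by
  refine ⟨(List.range a).map fun i => (List.range n).map (m i), (List.range b).map (m a),
    ((List.range' (b + 1) (n - b - 1)).map fun j => some (m a j)) ++ none ::
      ((List.range' (a + 1) (n - a - 1)).flatMap fun i =>
        (List.range n).map (fun j => some (m i j)) ++ [none]), by simp, by simp, by simp, ?_⟩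
  intro z
  have h1 : ∀ l : List ℕ, a ∉ l → (l.flatMap fun i => (List.range n).map (fun j =>
      some (Function.update m a (Function.update (m a) b z) i j)) ++ [none]) =
      l.flatMap fun i => (List.range n).map (fun j => some (m i j)) ++ [none] := by
    intro l hl
    refine List.flatMap_congr fun i hi => ?_
    rw [Function.update_of_ne (ne_of_mem_of_not_mem hi hl)]
  have h2 : ∀ l : List ℕ, b ∉ l → (l.map fun j => some (Function.update (m a) b z j)) =
      l.map fun j => some (m a j) := by
    intro l hl
    refine List.map_congr_left fun i hi => ?_
    rw [Function.update_of_ne (ne_of_mem_of_not_mem hi hl)]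
  have h3 : ∀ l : List Bool, (l.map fun c => [some c]).flatten = l.map some := by
    intro l
    induction l with
    | nil => rfl
    | cons c l ih => simp [ih]
  rw [encodeMatrix, range_eq_append_cons ha, List.flatMap_append, List.flatMap_cons,
    ← range_eq_append_cons ha, h1 _ (by simp), h1 _ (by simp), Function.update_self, h3]
  conv_lhs => rw [range_eq_append_cons hb]
  rw [List.map_append, List.map_cons, h2 _ (by simp), h2 _ (by simp), Function.update_self,
    ← range_eq_append_cons hb]
  simp [List.flatMap, Function.comp_def]

theorem encodeMatrix_length (n : ℕ) (m : ℕ → ℕ → Bool) :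
    (encodeMatrix n m).length = n * (n + 1) := by
  simp [encodeMatrix, List.length_flatMap]

/-- The row end stops the move while sitting in the register, already popped; a separate push
transfers it. -/
theorem runs_skipRow {I : Type} [DecidableEq I] {i j : I} (hij : i ≠ j) (s : σ)
    (r : Option (Option Bool)) (w : List Bool) (rest : List (Option Bool))
    (S : I → List (Option Bool)) (hS : S i = (w.map some ++ [none]) ++ rest) :
    (skipRow i j).Runs (s, r) S (s, some none) (Function.update (Function.update S j
      ((w.map some ++ [none]).reverse ++ S j)) i rest) (3 * w.length + 3) := by
  have h1 := runs_read i s r S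
  have h2 := runs_moveWhile (b := fun a : Option (Option Bool) => a != some none) hij s
    (rest := none :: rest) (by simp) (w.map some)
    (fun a ha => by obtain ⟨c, -, rfl⟩ := List.mem_map.1 ha; rfl) S
  rw [hS, List.append_assoc, List.singleton_append] at h1
  have h3 := fun S => runs_put j (none : Option Bool) (s, some none) S
  refine (h1.seq (h2.seq (h3 _))).congr rfl ?_ (by rw [List.length_map]; omega)
  funext k
  simp only [Function.update_apply]
  split_ifs <;> simp_all

theorem runs_access (n : ℕ) (r : R) (x y : V) (f : σ → Bool → σ × Bool) (e : V → ℕ)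
    (hx : e x < n) (hy : e y < n) (s : σ) (M : R → ℕ → ℕ → Bool) (q : Option (Option Bool)) :
    (access r x y f).compile.Runs (s, q) (memory n e M)
      (((access r x y f).eval n e (s, M)).1, none)
      (memory n e ((access r x y f).eval n e (s, M)).2) (20 * (n + 1) ^ 2) := by
  obtain ⟨B, C, T, hB, hC, hBn, h⟩ := encodeMatrix_eq_append n (M r) hx hy
  have h0 : encodeMatrix n (M r) = (B.map fun w => w.map some ++ [none]).flatten ++
      ((C.map fun c => [some c]).flatten ++ (some (M r (e x) (e y)) :: T)) := by
    rw [← h, Function.update_eq_self, Function.update_eq_self]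
  set FB := (B.map fun w => w.map some ++ [none]).flatten with hFB
  set FC := (C.map fun c => [some c]).flatten with hFC
  have r1 := runs_repeatCount (i := Stk.rel r) (j := .buf) (c := .lo x) (t := .tmp) (by simp)
    (by simp) (by simp) (by simp) (by simp) (by simp) (a := (none : Option Bool))
    (p := skipRow (.rel r) .buf) (s := s) (d := 3 * n + 3)
    (FC ++ (some (M r (e x) (e y)) :: T)) (B.map fun w => w.map some ++ [none]) (by
      intro b hb q S rest hS
      obtain ⟨w, hw, rfl⟩ := List.mem_map.1 hb
      refine ⟨_, (runs_skipRow (by simp) s q w rest S hS).mono ?_⟩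
      rw [hBn w hw]) q (memory n e M) (by simp [memory, hB]) rfl (by exact h0)
  obtain ⟨S, hS⟩ : ∃ S, S = Function.update (Function.update (memory n e M) Stk.buf
      FB.reverse) (Stk.rel r) (FC ++ (some (M r (e x) (e y)) :: T)) := ⟨_, rfl⟩
  replace r1 := r1.congr rfl (T' := S) (by rw [hS, ← hFB]; simp [memory]) le_rfl
  have r2 := runs_repeatCount (i := Stk.rel r) (j := .buf) (c := .lo y) (t := .tmp) (by simp)
    (by simp) (by simp) (by simp) (by simp) (by simp) (a := (none : Option Bool))
    (p := .seq (read (.rel r)) (write .buf)) (s := s) (d := 2)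
    (some (M r (e x) (e y)) :: T) (C.map fun c => [some c]) (by
      intro b hb q S rest hS
      obtain ⟨w, hw, rfl⟩ := List.mem_map.1 hb
      have g1 := runs_read (Stk.rel r) s q S
      rw [hS] at g1
      refine ⟨_, (g1.seq (runs_write _ s (some w) _)).congr rfl ?_ le_rfl⟩
      funext k
      simp only [Function.update_apply]
      split_ifs <;> simp_all) none S (by simp [hS, memory, hC]) (by simp [hS, memory])
      (by simp [hS, hFC])
  replace r2 := r2.congr rfl (T' := Function.update (Function.update S Stk.buf
    (FC.reverse ++ FB.reverse)) (Stk.rel r) (some (M r (e x) (e y)) :: T))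
    (by rw [← hFC]; simp [hS]) le_rfl
  have r3 := Runs.pop (Stk.rel r) (fun (v : σ × Option (Option Bool)) a =>
    ((f v.1 (a.join.getD false)).1, some (some (f v.1 (a.join.getD false)).2))) (s, none)
    (Function.update (Function.update S Stk.buf (FC.reverse ++ FB.reverse)) (Stk.rel r)
      (some (M r (e x) (e y)) :: T))
  simp only [Function.update_self, Function.update_idem, List.head?_cons, List.tail_cons,
    Option.join_some, Option.getD_some] at r3
  refine (r1.seq (r2.seq (r3.seq ((runs_write _ _ _ _).seq
    (runs_move (by simp) _ _ _))))).congr rfl ?_ ?_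
  · funext k
    rcases k with r' | x' | x' | _ | _
    · by_cases hr : r' = r
      · subst hr
        simp [hS, memory, eval, h]
      · simp [hS, memory, eval, hr]
    · simp [hS, memory]
    · simp [hS, memory]
    · simp [hS, memory]
    · simp [hS, memory]
  -- The parts moved to the buffer have total length at most `n * (n + 1)`, which bounds the time
  -- for pouring them back.
  · have hlen := congrArg List.length h0
    rw [encodeMatrix_length] at hlen
    simp only [List.length_append, List.length_cons] at hlen
    simp [hB, hC, hS]
    nlinarith

end LoopProg

/-! ### Correctness of the compilation of loop programs -/

namespace LoopProg

variable {R V σ : Type} [DecidableEq R] [DecidableEq V]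

open StackProg

/-- Variables outside the scope `D` have value `0`, so a loop over such a variable finds `lo x`
empty and all `n` symbols on `hi x`. The second component of the register is scratch space:
arbitrary at the start, `none` at the end. -/
theorem runs_compile (n : ℕ) (p : LoopProg R V σ) : ∀ (D : Finset V) (e : V → ℕ), p.Scoped D →
    (∀ x ∈ D, e x < n) → (∀ x ∉ D, e x = 0) → ∀ (s : σ) (q : Option (Option Bool))
    (M : R → ℕ → ℕ → Bool), p.compile.Runs (s, q) (memory n e M)
      ((p.eval n e (s, M)).1, none) (memory n e (p.eval n e (s, M)).2) (p.cost.eval n) := by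
  induction p with
  | access r x y f =>
    intro D e hD he _ s q M
    refine (runs_access n r x y f e (he x hD.1) (he y hD.2) s M q).mono ?_
    simp [cost]
  | seq p₁ p₂ ih₁ ih₂ =>
    intro D e hD he he' s q M
    refine ((ih₁ D e hD.1 he he' s q M).seq (ih₂ D e hD.2 he he' _ _ _)).congr rfl rfl ?_
    simp [cost]
  | forAll x p ih =>
    intro D e hD he he' s q M
    -- The state after `k` iterations. As `runs_drain` counts the iterations that are left, it is
    -- applied to the states `w (n - k)`.
    set w : ℕ → σ × (R → ℕ → ℕ → Bool) := fun k =>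
      (List.range k).foldl (fun v i => p.eval n (Function.update e x i) v) (s, M) with hw
    have hw' : ∀ k, w (k + 1) = p.eval n (Function.update e x k) (w k) := fun k => by
      simp [hw, List.range_succ]
    have h1 := runs_drain (i := Stk.hi x) (a := (none : Option Bool))
      (p := .seq (put (.hi x) none) (.seq p.compile (.seq (read (.hi x)) (put (.lo x) none))))
      (c := p.cost.eval n + 3) (fun k => (w (n - k)).1)
      (fun k => memory n (Function.update e x (n - k)) (w (n - k)).2) q n
      (fun k hk => by simp [memory, Nat.sub_sub_self hk]) (fun k hk => by
        have hk' : n - k = n - (k + 1) + 1 := by omega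
        have g := fun q => ih (insert x D) (Function.update e x (n - (k + 1))) hD.2
          (fun y hy => by
            by_cases hyx : y = x
            · subst hyx
              rw [Function.update_self]
              omega
            · rw [Function.update_of_ne hyx]
              exact he y (Finset.mem_of_mem_insert_of_ne hy hyx))
          (fun y hy => by
            rw [Finset.mem_insert, not_or] at hy
            rw [Function.update_of_ne hy.1]
            exact he' y hy.2) (w (n - (k + 1))).1 q (w (n - (k + 1))).2
        rw [Prod.mk.eta, ← hw' (n - (k + 1)), ← hk'] at g
        refine ⟨_, ((runs_put (Stk.hi x) none _ _).seq (((g _).congr_left rfl ?_).seq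
          ((runs_read (Stk.hi x) _ none _).seq (runs_put (Stk.lo x) none _ _)))).congr
            rfl ?_ (by omega)⟩
        · funext j
          rcases j with r' | x' | x' | _ | _
          · simp [memory]
          · simp [memory]
          · by_cases hx : x' = x
            · subst hx
              have : n - (n - (k + 1)) = k + 1 := by omega
              simp [memory, this, List.replicate_succ]
            · simp [memory, hx]
          · simp [memory]
          · simp [memory]
        · funext j
          rcases j with r' | x' | x' | _ | _
          · simp [memory]
          · by_cases hx : x' = x
            · subst hx
              simp [memory, hk', List.replicate_succ]
            · simp [memory, hx]
          · by_cases hx : x' = x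
            · subst hx
              have : n - (n - (k + 1)) - 1 = n - (n - k) := by omega
              simp [memory, this]
            · simp [memory, hx]
          · simp [memory]
          · simp [memory])
    have h2 := runs_move (i := Stk.lo x) (j := .hi x) (by simp) (w n).1 none
      (memory n (Function.update e x n) (w n).2)
    have hx : e x = 0 := he' x hD.1
    have hx' : Function.update e x 0 = e := by rw [← hx, Function.update_eq_self]
    simp only [Nat.sub_self, Nat.sub_zero] at h1
    refine ((h1.congr_left rfl ?_).seq h2).congr rfl ?_ ?_
    · simp [hw, hx']
    · funext j
      rcases j with r' | x' | x' | _ | _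
      · simp [memory, eval, hw]
      · by_cases hxx : x' = x
        · subst hxx
          simp [memory, hx]
        · simp [memory, hxx]
      · by_cases hxx : x' = x
        · subst hxx
          simp [memory, hx]
        · simp [memory, hxx]
      · simp [memory]
      · simp [memory]
    · simp [cost, memory]
      ring_nf
      omega

/-! ### Initialisation of the memory, and complete programs -/

/-- What the stacks receive from a symbol of the input while the memory is initialised: the
matrix `r₀` is copied, all other matrices are zero, and the ends of rows are counted. -/
def initStk (r₀ : R) : Stk R V → Option Bool → Option (Option Bool)
  | .rel r, a => some (if r = r₀ then a else a.map fun _ => false)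
  | .hi _, a => if a = none then some none else none
  | _, _ => none

/-- Initialise the memory, execute `p`, and empty all stacks. -/
noncomputable def toStackProg [Fintype R] [Fintype V] (r₀ : R) (p : LoopProg R V σ) :
    StackProg (Stk R V) (Option Bool) (σ × Option (Option Bool)) :=
  .seq (.seq (move (.rel r₀) .buf) (drain .buf (distribute (initStk r₀)))) (.seq p.compile clear)

/-- The matrices at the start of the execution. -/
def initMatrices (r₀ : R) (m : ℕ → ℕ → Bool) : R → ℕ → ℕ → Bool :=
  fun r => if r = r₀ then m else fun _ _ => false

-- The number `n` is recovered in unary as the number of row ends, which gives every stack `hi x`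
-- its initial contents.
omit [DecidableEq V] in
theorem filterMap_initStk (r₀ : R) (n : ℕ) (m : ℕ → ℕ → Bool) (k : Stk R V) :
    (encodeMatrix n m).filterMap (initStk r₀ k)
      = memory n (fun _ => 0) (initMatrices r₀ m) k := by
  rcases k with r | x | x | _ | _
  · by_cases h : r = r₀ <;>
      simp [memory, initStk, initMatrices, h, encodeMatrix, List.filterMap_flatMap,
        List.filterMap_map, Function.comp_def]
  · simp [memory, initStk]
  · change (encodeMatrix n m).filterMap
      (fun a => if a = none then some (none : Option Bool) else none) = List.replicate n none
    simp only [encodeMatrix, List.filterMap_flatMap]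
    exact List.eq_replicate_iff.2 ⟨by simp [List.length_flatMap, List.filterMap_map],
      by simp⟩
  · simp [memory, initStk]
  · simp [memory, initStk]

theorem eval_mono_nat (p : ℕ[X]) {a b : ℕ} (h : a ≤ b) : p.eval a ≤ p.eval b := by
  rw [eval_eq_sum, eval_eq_sum]
  exact Finset.sum_le_sum fun i _ => Nat.mul_le_mul_left _ (Nat.pow_le_pow_left h i)

/-- A bound for the running time in terms of the length of the input. -/
noncomputable def time [Fintype R] [Fintype V] (p : LoopProg R V σ) : ℕ[X] :=
  ((Fintype.card (Stk R V) + 6 : ℕ) : ℕ[X]) * X + 4 +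
    (p.cost + ((3 * X + 2) * ((Fintype.card (Stk R V) : ℕ) : ℕ[X]) + 1))

/-- The input is first reversed onto the buffer because distributing it reverses it again. The
stacks are cleared at the end because a halting configuration must contain nothing but the output.
-/
theorem runs_toStackProg [Fintype R] [Fintype V] (r₀ : R) (p : LoopProg R V σ) (hp : p.Scoped ∅)
    (s : σ) (n : ℕ) (m : ℕ → ℕ → Bool) :
    (p.toStackProg r₀).Runs (s, none)
      (Function.update (fun _ => []) (.rel r₀) (encodeMatrix n m))
      ((p.eval n (fun _ => 0) (s, initMatrices r₀ m)).1, none) (fun _ => [])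
      (p.time.eval (encodeMatrix n m).length) := by
  have h1 := runs_move (i := Stk.rel r₀) (j := (Stk.buf : Stk R V)) (by simp) s none
    (Function.update (fun _ => []) (.rel r₀) (encodeMatrix n m))
  have h2 := runs_drain_distribute (i := (Stk.buf : Stk R V)) (f := initStk r₀)
    (fun _ => rfl) s none (Function.update (fun _ => []) .buf (encodeMatrix n m).reverse)
  have h3 := runs_compile n p ∅ (fun _ => 0) hp (by simp) (by simp) s none (initMatrices r₀ m)
  have h4 := runs_clear (p.eval n (fun _ => 0) (s, initMatrices r₀ m)).1
    (memory n (fun _ : V => 0) (p.eval n (fun _ => 0) (s, initMatrices r₀ m)).2) (n * (n + 1)) (by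
      rintro (r' | x' | x' | _ | _)
      · simp [memory, encodeMatrix_length]
      · simp [memory]
      · simp [memory]
        nlinarith
      · simp [memory]
      · simp [memory])
  have h12 := (h1.congr rfl (T' := Function.update (fun _ => []) .buf
    (encodeMatrix n m).reverse) (by
      funext k
      simp only [Function.update_apply]
      split_ifs <;> simp_all) le_rfl).seq h2
  have h12' := h12.congr rfl (T' := memory n (fun _ => 0) (initMatrices r₀ m)) (by
    funext k
    by_cases hk : k = .buf
    · subst hk
      simp [memory]
    · rw [Function.update_of_ne hk, Function.update_of_ne hk, Function.update_self,
        List.reverse_reverse, filterMap_initStk, List.append_nil]) le_rfl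
  refine (h12'.seq (h3.seq h4)).mono ?_
  -- The cost is a polynomial in `n`; it is monotone, so it may be evaluated at the input length `n
  -- * (n + 1)` instead.
  have hle : n ≤ n * (n + 1) := by nlinarith
  have := eval_mono_nat p.cost hle
  simp only [time, encodeMatrix_length, Function.update_self, List.length_reverse, eval_add,
    eval_mul, eval_X, eval_natCast, eval_ofNat, eval_one, Nat.cast_id]
  have h5 : 3 * (n * (n + 1)) + 2 + ((Fintype.card (Stk R V) + 3) * (n * (n + 1)) + 2) =
      (Fintype.card (Stk R V) + 6) * (n * (n + 1)) + 4 := by ring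
  rw [h5]
  omega

end LoopProg

/-! ### From stack programs to Turing machines -/

namespace StackProg

variable {I A τ : Type}

/-- The Turing machine that executes a program, starting with the input on stack `inp`, writes
the answer, and halts. -/
def machine [DecidableEq I] [Fintype I] [Fintype A] [Inhabited A] [Fintype τ]
    (p : StackProg I A τ) (inp : I) (v₀ : τ) (ans : τ → Bool) : Turing.FinTM2 :=
  letI := p.labelFintype
  { K := Option I
    k₀ := some inp
    k₁ := none
    Γ := Alphabet I A
    Λ := Option p.Label
    main := some p.entry
    σ := τ
    initialState := v₀
    Γk₀Fin := inferInstanceAs (Fintype A)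
    m := fun l => match l with
      | some l => p.code some none l
      -- The required halting configuration has the initial register value, so the register is reset
      -- after the answer is written.
      | none => .push none ans (.load (fun _ => v₀) .halt) }

/-- The step beyond `t` is the one that writes the answer and halts. -/
theorem machine_outputs [DecidableEq I] [Fintype I] [Fintype A] [Inhabited A] [Fintype τ]
    {p : StackProg I A τ} {inp : I} {v₀ v : τ} {ans : τ → Bool} {l : List A} {t : ℕ}
    (h : p.Runs v₀ (Function.update (fun _ => []) inp l) v (fun _ => []) t) :
    Nonempty (Turing.TM2OutputsInTime (p.machine inp v₀ ans)
      (l.map (Equiv.refl A).invFun) (some [ans v]) (t + 1)) := by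
  obtain ⟨k, hk, hr⟩ := h.reaches (M := (p.machine inp v₀ ans).m) some none fun _ => rfl
  have hinit : ∀ l' : List A, l' = l → Turing.initList (p.machine inp v₀ ans) l'
      = ⟨some (some p.entry), v₀, toStacks (Function.update (fun _ => []) inp l)⟩ := by
    rintro l rfl
    unfold Turing.initList
    congr 1
    funext k
    by_cases hk : k = some inp
    · subst hk
      simp [machine, toStacks]
      rfl
    · rcases k with _ | i
      · rfl
      · have hi : i ≠ inp := fun h => hk (congrArg some h)
        have hk' : ¬ (some i : Option I) = (p.machine inp v₀ ans).k₀ := hk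
        refine (dif_neg hk').trans ?_
        exact (Function.update_of_ne hi l fun _ => ([] : List A)).symm
  have hhalt : Turing.haltList (p.machine inp v₀ ans) [ans v]
      = ⟨none, v₀, Function.update (toStacks fun _ => []) none [ans v]⟩ := by
    unfold Turing.haltList
    congr 1
    funext k
    rcases k with _ | i
    · rfl
    · rfl
  refine ⟨⟨⟨k + 1, ?_⟩, Nat.succ_le_succ hk⟩⟩
  refine (congrArg (fun c => (flip bind (p.machine inp v₀ ans).step)^[k + 1] (some c))
    (hinit _ (List.map_id l))).trans ?_
  rw [Option.map_some, hhalt, add_comm, Function.iterate_add_apply]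
  exact congrArg _ hr

end StackProg

/-- A problem on instances that are encoded by Boolean matrices is solvable in polynomial time if
it is decided by a loop program. -/
theorem solvableInPolyTime_of_loopProg {α R V σ : Type} [DecidableEq R] [DecidableEq V]
    [Fintype R] [Fintype V] [Fintype σ] {enc : Computability.Encoding α (Option Bool)}
    {problem : α → Prop} (dim : α → ℕ) (mat : α → ℕ → ℕ → Bool)
    (henc : ∀ a, enc.encode a = LoopProg.encodeMatrix (dim a) (mat a))
    (r₀ : R) (p : LoopProg R V σ) (hp : p.Scoped ∅) (s : σ) (ans : σ → Bool)
    (h : ∀ a, ans (p.eval (dim a) (fun _ => 0) (s, LoopProg.initMatrices r₀ (mat a))).1 = true ↔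
      problem a) :
    SolvableInPolyTime enc problem := by
  classical
  refine ⟨{
    tm := (p.toStackProg r₀).machine (.rel r₀) (s, none) fun v => ans v.1
    inputAlphabet := Equiv.refl (Option Bool)
    outputAlphabet := Equiv.refl Bool
    time := p.time + 1
    outputsFun := fun a => Classical.choice ?_ }⟩
  have h1 := StackProg.machine_outputs (ans := fun v => ans v.1)
    (LoopProg.runs_toStackProg r₀ p hp s (dim a) (mat a))
  have h2 : ans (p.eval (dim a) (fun _ => 0) (s, LoopProg.initMatrices r₀ (mat a))).1
      = decide (problem a) := by
    rw [Bool.eq_iff_iff, h a, decide_eq_true_iff]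
  rw [← henc] at h1
  simp only [h2] at h1
  rw [Polynomial.eval_add, Polynomial.eval_one]
  exact h1

/-- The Boolean matrix of a relation on `Fin n`. -/
noncomputable def matrixOf (n : ℕ) (r : Fin n → Fin n → Prop) (i j : ℕ) : Bool :=
  open Classical in decide (∃ (hi : i < n) (hj : j < n), r ⟨i, hi⟩ ⟨j, hj⟩)

theorem encodeAdj_eq_encodeMatrix (n : ℕ) (r : Fin n → Fin n → Prop) :
    encodeAdj n r = LoopProg.encodeMatrix n (matrixOf n r) := by
  have h : ∀ i j : Fin n, matrixOf n r i j = (open Classical in decide (r i j)) := by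
    intro i j
    simp [matrixOf]
  rw [encodeAdj, LoopProg.encodeMatrix, ← List.map_coe_finRange_eq_range, List.flatMap_map]
  simp only [List.map_map, Function.comp_def, h]

/-! ### Chromatically invariant oriented graphs -/

theorem SimpleGraph.eval_chromaticPolynomial {V : Type} [Finite V] (Γ : SimpleGraph V) (k : ℕ) :
    Γ.chromaticPolynomial.eval (k : ℚ) = (Nat.card (Γ.Coloring (Fin k)) : ℚ) :=
  Γ.existsUnique_chromaticPolynomial.choose_spec.1 k

theorem OrientedGraph.eval_chromaticPolynomial {V : Type} [Finite V] (G : OrientedGraph V)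
    (k : ℕ) : G.chromaticPolynomial.eval (k : ℚ)
      = (Nat.card {c : V → Fin k // G.IsColoring c} : ℚ) :=
  G.existsUnique_chromaticPolynomial.choose_spec.1 k

theorem OrientedGraph.underlying_adj {V : Type} (G : OrientedGraph V) (u v : V) :
    G.underlying.Adj u v ↔ G.Adj u v ∨ G.Adj v u := by
  refine ⟨fun h => h.2, fun h => ⟨?_, h⟩⟩
  rintro rfl
  exact G.irrefl u (h.elim id id)

theorem SimpleGraph.card_coloring {V : Type} (Γ : SimpleGraph V) (k : ℕ) :
    Nat.card (Γ.Coloring (Fin k))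
      = Nat.card {c : V → Fin k // ∀ u v : V, Γ.Adj u v → c u ≠ c v} := Nat.card_congr
  { toFun := fun c => ⟨c, fun _ _ h => c.valid h⟩
    invFun := fun c => SimpleGraph.Coloring.mk c.1 fun {u v} h => c.2 u v h
    left_inv := fun _ => rfl
    right_inv := fun _ => rfl }

/-- `G` is chromatically invariant if and only if all proper colourings of its underlying graph
are oriented colourings. -/
theorem OrientedGraph.chromaticPolynomial_eq_iff {V : Type} [Finite V] (G : OrientedGraph V) :
    G.chromaticPolynomial = G.underlying.chromaticPolynomial ↔
      ∀ (k : ℕ) (c : V → Fin k), (∀ u v, G.underlying.Adj u v → c u ≠ c v) →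
        G.IsColoring c := by
  have hsub : ∀ k, {c : V → Fin k | G.IsColoring c} ⊆
      {c | ∀ u v, G.underlying.Adj u v → c u ≠ c v} := by
    intro k c hc u v h
    rcases (G.underlying_adj u v).1 h with h | h
    · exact hc.1 u v h
    · exact (hc.1 v u h).symm
  constructor
  · intro h k c hc
    have hk : (Nat.card {c : V → Fin k // G.IsColoring c} : ℚ)
        = Nat.card (G.underlying.Coloring (Fin k)) := by
      rw [← G.eval_chromaticPolynomial, h, SimpleGraph.eval_chromaticPolynomial]
    rw [SimpleGraph.card_coloring, Nat.cast_inj] at hk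
    -- An inclusion between finite sets of equal cardinality is an equality.
    have heq := Set.eq_of_subset_of_ncard_le (hsub k) (le_of_eq hk.symm) (Set.toFinite _)
    have hc' : c ∈ {c : V → Fin k | ∀ u v, G.underlying.Adj u v → c u ≠ c v} := hc
    rw [← heq] at hc'
    exact hc'
  · intro h
    refine G.underlying.existsUnique_chromaticPolynomial.unique (fun k => ?_)
      G.underlying.existsUnique_chromaticPolynomial.choose_spec.1
    rw [G.eval_chromaticPolynomial, SimpleGraph.card_coloring, Nat.cast_inj]
    exact congrArg Set.ncard ((hsub k).antisymm fun c hc => h k c hc)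

/-- If the adjacency condition fails for `uv` and `xy`, merging `y` into `u` and `x` into `v` gives
a proper colouring that violates the second colouring axiom. Conversely, an adjacency on the right
is exactly what excludes a violation by these two arcs. The case `x = v` says that directed paths
with two arcs are not induced. -/
theorem OrientedGraph.chromaticPolynomial_eq_iff_forall_adj {V : Type} [Finite V]
    (G : OrientedGraph V) :
    G.chromaticPolynomial = G.underlying.chromaticPolynomial ↔
      ∀ u v x y, G.Adj u v → G.Adj x y → G.underlying.Adj u y ∨ G.underlying.Adj v x := by
  classical
  rw [G.chromaticPolynomial_eq_iff]
  constructor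
  · intro h u v x y huv hxy
    by_contra! hcon
    obtain ⟨huy, hvx⟩ := hcon
    have huv' : G.underlying.Adj u v := (G.underlying_adj _ _).2 (Or.inl huv)
    have hxy' : G.underlying.Adj x y := (G.underlying_adj _ _).2 (Or.inl hxy)
    have hux : u ≠ x := by
      rintro rfl
      exact huy hxy'
    have hvy : v ≠ y := by
      rintro rfl
      exact huy huv'
    obtain ⟨k, ⟨e⟩⟩ := Finite.exists_equiv_fin V
    -- Distinct vertices that get merged are nonadjacent, and the edge `xy` is sent to the edge
    -- `vu`, so `φ` composed with an injection into colours is proper.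
    let φ : V → V := fun w => if w = y then u else if w = x then v else w
    have hφ : ∀ a b, G.underlying.Adj a b → φ a ≠ φ b := by
      intro a b hab
      have h1 := hab.ne
      have h2 := hab.symm
      have h3 := huv'.ne
      have h4 := hxy'.ne
      simp only [φ]
      split_ifs <;> (try subst_vars) <;>
        first
        | contradiction
        | assumption
        | exact h3.symm
        | (rintro rfl; first | exact huy hab | exact huy h2 | exact hvx hab | exact hvx h2)
    have hc := (h k (e ∘ φ) fun a b hab => e.injective.ne (hφ a b hab)).2 u v x y huv hxy
    have hu : φ u = φ y := by
      by_cases huy' : u = y <;> simp [φ, hux, huy']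
    have hv : φ v = φ x := by
      by_cases hvx' : v = x <;> simp [φ, hvy, hvx', hxy'.ne]
    exact hc (congrArg e hu) (congrArg e hv)
  · intro h k c hc
    refine ⟨fun u v huv => hc u v ((G.underlying_adj _ _).2 (Or.inl huv)), ?_⟩
    intro u v x y huv hxy hu hv
    rcases h u v x y huv hxy with h' | h'
    · exact hc _ _ h' hu
    · exact hc _ _ h' hv

/-! ### Graphs with a chromatically invariant orientation -/

/-- Two arcs `p` and `q` on edges of `Γ` such that no chromatically invariant orientation of `Γ`
contains `p` and the reversal of `q`. -/
def SimpleGraph.Forces {V : Type} (Γ : SimpleGraph V) (p q : V × V) : Prop :=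
  Γ.Adj p.1 p.2 ∧ Γ.Adj q.1 q.2 ∧ ¬ Γ.Adj p.1 q.1 ∧ ¬ Γ.Adj p.2 q.2

namespace SimpleGraph

variable {V : Type} {Γ : SimpleGraph V}

theorem Forces.symm {p q : V × V} (h : Γ.Forces p q) : Γ.Forces q p :=
  ⟨h.2.1, h.1, fun h' => h.2.2.1 h'.symm, fun h' => h.2.2.2 h'.symm⟩

theorem Forces.swap {p q : V × V} (h : Γ.Forces p q) : Γ.Forces p.swap q.swap :=
  ⟨h.1.symm, h.2.1.symm, h.2.2.2, h.2.2.1⟩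

theorem forces_reflTransGen_symm {p q : V × V} (h : Relation.ReflTransGen Γ.Forces p q) :
    Relation.ReflTransGen Γ.Forces q p := by
  induction h with
  | refl => exact .refl
  | tail _ h ih => exact .head h.symm ih

/-- The equivalence classes of arcs that force each other. -/
def forcesSetoid (Γ : SimpleGraph V) : Setoid (V × V) where
  r := Relation.ReflTransGen Γ.Forces
  iseqv := ⟨fun _ => .refl, forces_reflTransGen_symm, .trans⟩

/-- An invariant orientation is closed under forcing, so a chain from an arc to its reversal would
put both into it. Conversely, fix a well-order on the forcing classes and orient each edge in the
direction with the smaller class. Reversal respects forcing (`Forces.swap`), so arcs that force each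
other are chosen together. -/
theorem exists_orientation_iff (Γ : SimpleGraph V) :
    (∃ O : OrientedGraph V, O.underlying = Γ ∧
      ∀ u v x y, O.Adj u v → O.Adj x y → Γ.Adj u y ∨ Γ.Adj v x) ↔
    ∀ a b, Γ.Adj a b → ¬ Relation.ReflTransGen Γ.Forces (a, b) (b, a) := by
  constructor
  · rintro ⟨O, hO, h⟩ a b hab hr
    have key : ∀ p q : V × V, Relation.ReflTransGen Γ.Forces p q → O.Adj p.1 p.2 →
        O.Adj q.1 q.2 := by
      intro p q hpq hp
      induction hpq with
      | refl => exact hp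
      | tail _ h' ih =>
        have h2 := h'.2.1
        rw [← hO, O.underlying_adj] at h2
        rcases h2 with h2 | h2
        · exact h2
        · exact ((h _ _ _ _ ih h2).elim h'.2.2.1 h'.2.2.2).elim
    rw [← hO, O.underlying_adj] at hab
    rcases hab with hab | hab
    · exact O.antisymm a b hab (key _ _ hr hab)
    · exact O.antisymm b a hab (key _ _ (forces_reflTransGen_symm hr) hab)
  · intro h
    let cls : V × V → Quotient Γ.forcesSetoid := fun p => ⟦p⟧
    have hcls : ∀ {p q}, Γ.Forces p q → cls p = cls q := fun hpq =>
      Quotient.sound (Relation.ReflTransGen.single hpq)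
    let O : OrientedGraph V :=
      { Adj := fun a b => Γ.Adj a b ∧ WellOrderingRel (cls (a, b)) (cls (b, a))
        irrefl := fun u hu => Γ.irrefl hu.1
        antisymm := fun u v huv hvu => _root_.asymm huv.2 hvu.2 }
    have hO : O.underlying = Γ := by
      ext a b
      rw [O.underlying_adj]
      constructor
      · rintro (h' | h')
        · exact h'.1
        · exact h'.1.symm
      · intro hab
        -- The hypothesis says that the two directions of an edge lie in different classes, so one
        -- of them is chosen.
        rcases trichotomous_of WellOrderingRel (cls (a, b)) (cls (b, a)) with h' | h' | h'
        · exact Or.inl ⟨hab, h'⟩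
        · exact (h a b hab (Quotient.exact h')).elim
        · exact Or.inr ⟨hab.symm, h'⟩
    refine ⟨O, hO, fun u v x y huv hxy => ?_⟩
    by_contra! hcon
    -- A violation by `uv` and `xy` means that `uv` forces the reversal of `xy`.
    have hF : Γ.Forces (u, v) (y, x) := ⟨huv.1, hxy.1.symm, hcon.1, hcon.2⟩
    have h1 : WellOrderingRel (cls (y, x)) (cls (x, y)) := by
      have h2 := hcls hF.swap
      simp only [Prod.swap_prod_mk] at h2
      rw [← hcls hF, ← h2]
      exact huv.2
    exact _root_.asymm h1 hxy.2

end SimpleGraph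

theorem oChromInvar_iff (a : OrientedGraphInstance) : OChromInvar a ↔
    ∀ u v x y, a.2.Adj u v → a.2.Adj x y →
      (a.2.Adj u y ∨ a.2.Adj y u) ∨ (a.2.Adj v x ∨ a.2.Adj x v) := by
  simp only [← OrientedGraph.underlying_adj]
  exact a.2.chromaticPolynomial_eq_iff_forall_adj

theorem chromInvar_iff (a : GraphInstance) : ChromInvar a ↔
    ∀ u v, a.2.Adj u v → ¬ Relation.ReflTransGen a.2.Forces (u, v) (v, u) := by
  rw [← SimpleGraph.exists_orientation_iff]
  refine exists_congr fun O => and_congr_right fun hO => ?_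
  rw [← hO]
  exact O.chromaticPolynomial_eq_iff_forall_adj

/-! ### Rules for verifying loop programs -/

namespace LoopProg

section Rules

variable {R V σ : Type} [DecidableEq R] [DecidableEq V]

/-- Read a matrix entry. -/
def test (r : R) (x y : V) (f : σ → Bool → σ) : LoopProg R V σ := access r x y fun s b => (f s b, b)

theorem eval_test (n : ℕ) (r : R) (x y : V) (f : σ → Bool → σ) (e : V → ℕ)
    (w : σ × (R → ℕ → ℕ → Bool)) :
    (test r x y f).eval n e w = (f w.1 (w.2 r (e x) (e y)), w.2) := by
  simp [test, eval]

theorem eval_forAll_induction {n : ℕ} {x : V} {p : LoopProg R V σ} {e : V → ℕ}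
    {w : σ × (R → ℕ → ℕ → Bool)} (P : ℕ → σ × (R → ℕ → ℕ → Bool) → Prop) (h0 : P 0 w)
    (h : ∀ i < n, ∀ w, P i w → P (i + 1) (p.eval n (Function.update e x i) w)) :
    P n ((forAll x p).eval n e w) := by
  have key : ∀ k ≤ n, P k ((List.range k).foldl
      (fun v i => p.eval n (Function.update e x i) v) w) := by
    intro k hk
    induction k with
    | zero => exact h0
    | succ k ih =>
      rw [List.range_succ, List.foldl_concat]
      exact h k hk _ (ih (by omega))
  exact key n le_rfl

/-- If the iterations go up in a preorder `le`, and the `i`-th one establishes an upward closed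
property `Q i`, then the loop establishes all of these properties. -/
theorem eval_forAll_mono {n : ℕ} {x : V} {p : LoopProg R V σ} {e : V → ℕ}
    {w : σ × (R → ℕ → ℕ → Bool)}
    (le : σ × (R → ℕ → ℕ → Bool) → σ × (R → ℕ → ℕ → Bool) → Prop)
    (hrefl : ∀ w, le w w) (htrans : ∀ w₁ w₂ w₃, le w₁ w₂ → le w₂ w₃ → le w₁ w₃)
    (I : σ × (R → ℕ → ℕ → Bool) → Prop) (Q : Fin n → σ × (R → ℕ → ℕ → Bool) → Prop)
    (hQ : ∀ i w w', le w w' → Q i w → Q i w')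
    (h : ∀ (i : Fin n) w, I w → I (p.eval n (Function.update e x i) w) ∧
      le w (p.eval n (Function.update e x i) w) ∧ Q i (p.eval n (Function.update e x i) w))
    (hw : I w) :
    I ((forAll x p).eval n e w) ∧ le w ((forAll x p).eval n e w) ∧
      ∀ i, Q i ((forAll x p).eval n e w) := by
  have := eval_forAll_induction (n := n) (x := x) (p := p) (e := e) (w := w)
    (fun k w' => I w' ∧ le w w' ∧ ∀ i : Fin n, i.1 < k → Q i w')
    ⟨hw, hrefl w, fun i hi => absurd hi (Nat.not_lt_zero _)⟩ (by
      rintro i hi w' ⟨h1, h2, h3⟩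
      obtain ⟨g1, g2, g3⟩ := h ⟨i, hi⟩ w' h1
      refine ⟨g1, htrans _ _ _ h2 g2, fun j hj => ?_⟩
      rcases Nat.lt_succ_iff_lt_or_eq.1 hj with hj | hj
      · exact hQ _ _ _ g2 (h3 j hj)
      · obtain rfl : j = ⟨i, hi⟩ := Fin.ext hj
        exact g3)
  exact ⟨this.1, this.2.1, fun i => this.2.2 i i.2⟩

/-- If the iterations preserve `I`, and the `i`-th one replaces the answer by its conjunction
with `Q i`, then the loop replaces it by its conjunction with all `Q i`. -/
theorem eval_forAll_and {n : ℕ} {x : V} {p : LoopProg R V σ} {e : V → ℕ}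
    {w : σ × (R → ℕ → ℕ → Bool)} (ans : σ → Bool) (I : σ × (R → ℕ → ℕ → Bool) → Prop)
    (Q : Fin n → Prop)
    (h : ∀ (i : Fin n) w, I w → I (p.eval n (Function.update e x i) w) ∧
      (ans (p.eval n (Function.update e x i) w).1 = true ↔ ans w.1 = true ∧ Q i))
    (hw : I w) :
    I ((forAll x p).eval n e w) ∧
      (ans ((forAll x p).eval n e w).1 = true ↔ ans w.1 = true ∧ ∀ i, Q i) := by
  have := eval_forAll_induction (n := n) (x := x) (p := p) (e := e) (w := w)
    (fun k w' => I w' ∧ (ans w'.1 = true ↔ ans w.1 = true ∧ ∀ i : Fin n, i.1 < k → Q i))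
    ⟨hw, by simp⟩ (by
      rintro i hi w' ⟨h1, h2⟩
      obtain ⟨g1, g2⟩ := h ⟨i, hi⟩ w' h1
      refine ⟨g1, ?_⟩
      rw [g2, h2, and_assoc]
      refine and_congr_right fun _ => ⟨fun hh j hj => ?_, fun hh => ⟨fun j hj => ?_, ?_⟩⟩
      · rcases Nat.lt_succ_iff_lt_or_eq.1 hj with hj | hj
        · exact hh.1 j hj
        · obtain rfl : j = ⟨i, hi⟩ := Fin.ext hj
          exact hh.2
      · exact hh j (by omega)
      · exact hh ⟨i, hi⟩ (by simp))
  refine ⟨this.1, this.2.trans (and_congr_right fun _ => ?_)⟩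
  exact ⟨fun hh i => hh i i.2, fun hh i _ => hh i⟩

end Rules

/-! ### A loop program for OCHROM-INVAR -/

/-- Check the condition on the arcs `uv` and `xy`, where `u, v, x, y` are the variables
`0, 1, 2, 3`. The register holds the answer and an auxiliary bit. -/
def oChromCheck : LoopProg Unit (Fin 4) (Bool × Bool) :=
  .seq (test () 0 1 fun s b => (s.1, b)) <|
  .seq (test () 2 3 fun s b => (s.1, s.2 && b)) <|
  .seq (test () 0 3 fun s b => (s.1, s.2 && !b)) <|
  .seq (test () 3 0 fun s b => (s.1, s.2 && !b)) <|
  .seq (test () 1 2 fun s b => (s.1, s.2 && !b)) <|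
  test () 2 1 fun s b => (s.1 && !(s.2 && !b), s.2)

/-- A program that decides OCHROM-INVAR. -/
def oChromProg : LoopProg Unit (Fin 4) (Bool × Bool) :=
  .forAll 0 <| .forAll 1 <| .forAll 2 <| .forAll 3 oChromCheck

theorem matrixOf_coe {n : ℕ} {r : Fin n → Fin n → Prop} (i j : Fin n) :
    matrixOf n r i j = true ↔ r i j := by
  simp [matrixOf]

theorem eval_oChromCheck {n : ℕ} (r : Fin n → Fin n → Prop) (u v x y : Fin n) (e : Fin 4 → ℕ)
    (h0 : e 0 = u) (h1 : e 1 = v) (h2 : e 2 = x) (h3 : e 3 = y)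
    (w : (Bool × Bool) × (Unit → ℕ → ℕ → Bool)) (hw : w.2 () = matrixOf n r) :
    (oChromCheck.eval n e w).2 () = matrixOf n r ∧
    ((oChromCheck.eval n e w).1.1 = true ↔
      w.1.1 = true ∧ (r u v → r x y → (r u y ∨ r y u) ∨ (r v x ∨ r x v))) := by
  simp only [oChromCheck, eval, eval_test, h0, h1, h2, h3, hw, ← matrixOf_coe (r := r)]
  refine ⟨trivial, ?_⟩
  -- The claim involves only six matrix entries and the old answer, since the auxiliary bit is
  -- overwritten by the first test; a truth table settles it.
  generalize matrixOf n r u v = b1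
  generalize matrixOf n r x y = b2
  generalize matrixOf n r u y = b3
  generalize matrixOf n r y u = b4
  generalize matrixOf n r v x = b5
  generalize matrixOf n r x v = b6
  generalize w.1.1 = b7
  revert b1 b2 b3 b4 b5 b6 b7
  decide

theorem eval_oChromProg {n : ℕ} (r : Fin n → Fin n → Prop) (e : Fin 4 → ℕ)
    (w : (Bool × Bool) × (Unit → ℕ → ℕ → Bool)) (hw : w.2 () = matrixOf n r) :
    (oChromProg.eval n e w).1.1 = true ↔ w.1.1 = true ∧
      ∀ u v x y, r u v → r x y → (r u y ∨ r y u) ∨ (r v x ∨ r x v) := by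
  refine (eval_forAll_and Prod.fst (fun w => w.2 () = matrixOf n r) _ (fun u w hw => ?_) hw).2
  refine eval_forAll_and Prod.fst (fun w => w.2 () = matrixOf n r) _ (fun v w hw => ?_) hw
  refine eval_forAll_and Prod.fst (fun w => w.2 () = matrixOf n r) _ (fun x w hw => ?_) hw
  refine eval_forAll_and Prod.fst (fun w => w.2 () = matrixOf n r) _ (fun y w hw => ?_) hw
  exact eval_oChromCheck r u v x y _ (by simp [Function.update]) (by simp [Function.update])
    (by simp [Function.update]) (by simp [Function.update]) w hw

end LoopProg

theorem oChromInvar_solvableInPolyTime :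
    SolvableInPolyTime orientedGraphEncoding OChromInvar := by
  refine solvableInPolyTime_of_loopProg (fun a => a.1) (fun a => matrixOf a.1 a.2.Adj)
    (fun a => encodeAdj_eq_encodeMatrix _ _) () LoopProg.oChromProg ?_ (true, true) Prod.fst
    fun a => ?_
  · simp [LoopProg.oChromProg, LoopProg.oChromCheck, LoopProg.test, LoopProg.Scoped]
  · rw [oChromInvar_iff, LoopProg.eval_oChromProg a.2.Adj _ _ rfl]
    simp

/-! ### A loop program for CHROM-INVAR -/

namespace SimpleGraph

/-- A path visits each pair of vertices at most once, which bounds the number of marking rounds. The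
walk goes from `q` back to `s`, so that its first edge is the last forcing step. -/
theorem exists_walk_of_reflTransGen_forces {V : Type} [Fintype V] {Γ : SimpleGraph V}
    {s q : V × V} (h : Relation.ReflTransGen Γ.Forces s q) :
    ∃ p : (SimpleGraph.fromRel Γ.Forces).Walk q s, p.length ≤ Fintype.card (V × V) := by
  classical
  have hr : (SimpleGraph.fromRel Γ.Forces).Reachable q s := by
    induction h with
    | refl => exact .refl _
    | @tail b c _ h ih =>
      -- The graph `fromRel` has no loops, whereas every arc on an edge forces itself.
      by_cases hbc : c = b
      · exact hbc ▸ ih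
      · have hadj : (SimpleGraph.fromRel Γ.Forces).Adj c b := ⟨hbc, Or.inr h⟩
        exact hadj.reachable.trans ih
  obtain ⟨p, hp⟩ := hr.exists_isPath
  exact ⟨p, hp.length_lt.le⟩

end SimpleGraph

namespace LoopProg

/-- Mark the arc `xy` if the arc `uv` is marked and forces it, where `u, v, x, y` are the
variables `4, 5, 6, 7`. The matrix `true` is the adjacency matrix, and the matrix `false` holds
the marks. -/
def chromStep : LoopProg Bool (Fin 8) (Bool × Bool) :=
  .seq (test false 4 5 fun s b => (s.1, b)) <|
  .seq (test true 4 5 fun s b => (s.1, s.2 && b)) <|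
  .seq (test true 6 7 fun s b => (s.1, s.2 && b)) <|
  .seq (test true 4 6 fun s b => (s.1, s.2 && !b)) <|
  .seq (test true 5 7 fun s b => (s.1, s.2 && !b)) <|
  access false 6 7 fun s b => (s, b || s.2)

/-- Mark all arcs that are forced by marked arcs. -/
def chromRound : LoopProg Bool (Fin 8) (Bool × Bool) :=
  .forAll 4 <| .forAll 5 <| .forAll 6 <| .forAll 7 chromStep

/-- Remove all marks. -/
def chromReset : LoopProg Bool (Fin 8) (Bool × Bool) :=
  .forAll 4 <| .forAll 5 <| access false 4 5 fun s _ => (s, false)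

/-- Check that the arc `ab` does not force its reversal, where `a, b` are the variables
`0, 1`. -/
def chromCheck : LoopProg Bool (Fin 8) (Bool × Bool) :=
  .seq chromReset <|
  .seq (access false 0 1 fun s _ => (s, true)) <|
  .seq (.forAll 2 <| .forAll 3 chromRound) <|
  .seq (test false 1 0 fun s b => (s.1, b)) <|
  test true 0 1 fun s b => (s.1 && !(s.2 && b), s.2)

/-- A program that decides CHROM-INVAR. -/
def chromProg : LoopProg Bool (Fin 8) (Bool × Bool) := .forAll 0 <| .forAll 1 chromCheck

/-- The states of the programs for CHROM-INVAR. -/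
abbrev ChromState : Type := (Bool × Bool) × (Bool → ℕ → ℕ → Bool)

/-- The adjacency matrix and the answer are the same, and there are more marks. -/
def ChromState.le (w w' : ChromState) : Prop :=
  w'.2 true = w.2 true ∧ w'.1.1 = w.1.1 ∧ ∀ i j, w.2 false i j = true → w'.2 false i j = true

theorem ChromState.le_refl (w : ChromState) : w.le w := ⟨rfl, rfl, fun _ _ h => h⟩

theorem ChromState.le_trans (w₁ w₂ w₃ : ChromState) (h : w₁.le w₂) (h' : w₂.le w₃) : w₁.le w₃ :=
  ⟨h'.1.trans h.1, h'.2.1.trans h.2.1, fun i j hij => h'.2.2 i j (h.2.2 i j hij)⟩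

variable {n : ℕ} {Γ : SimpleGraph (Fin n)}

theorem eval_chromStep (u v x y : Fin n) (e : Fin 8 → ℕ) (h4 : e 4 = u) (h5 : e 5 = v)
    (h6 : e 6 = x) (h7 : e 7 = y) (w : ChromState) (hw : w.2 true = matrixOf n Γ.Adj) :
    ChromState.le w (chromStep.eval n e w) ∧
    ∀ i j, (chromStep.eval n e w).2 false i j = true ↔ w.2 false i j = true ∨
      (i = x ∧ j = y ∧ w.2 false u v = true ∧ Γ.Forces (u, v) (x, y)) := by
  have key : ∀ i j, (chromStep.eval n e w).2 false i j = true ↔ w.2 false i j = true ∨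
      (i = x ∧ j = y ∧ w.2 false u v = true ∧ Γ.Forces (u, v) (x, y)) := by
    intro i j
    simp only [chromStep, eval, eval_test, h4, h5, h6, h7, hw, Function.update_self,
      SimpleGraph.Forces, ← matrixOf_coe (r := Γ.Adj)]
    by_cases hi : i = x
    · subst hi
      by_cases hj : j = y
      · subst hj
        simp [and_assoc]
      · simp [hj]
    · simp [hi]
  refine ⟨⟨?_, ?_, fun i j hij => (key i j).2 (Or.inl hij)⟩, key⟩
  · simp [chromStep, eval, eval_test]
  · simp [chromStep, eval, eval_test]

/-- The marked arcs are forced by `s`. -/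
def ChromState.Sound (Γ : SimpleGraph (Fin n)) (s : Fin n × Fin n) (w : ChromState) : Prop :=
  w.2 true = matrixOf n Γ.Adj ∧
    ∀ q : Fin n × Fin n, w.2 false q.1 q.2 = true → Relation.ReflTransGen Γ.Forces s q

/-- Marks are updated in place, so new marks may already spread within the round. Only two bounds
are therefore tracked: all marks are reachable from `s`, and everything forced by a mark present at
the start `w` is marked. The invariant includes `w.le w'` so that the marks of `w` are still there
when they are used. -/
theorem eval_chromRound (s : Fin n × Fin n) (e : Fin 8 → ℕ) (w : ChromState)
    (hw : w.Sound Γ s) :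
    ChromState.Sound Γ s (chromRound.eval n e w) ∧ w.le (chromRound.eval n e w) ∧
    ∀ u v x y : Fin n, w.2 false u v = true → Γ.Forces (u, v) (x, y) →
      (chromRound.eval n e w).2 false x y = true := by
  have h := eval_forAll_mono (n := n) (x := 4) (p := .forAll 5 <| .forAll 6 <| .forAll 7 chromStep)
    (e := e) (w := w) ChromState.le ChromState.le_refl ChromState.le_trans
    (fun w' => ChromState.Sound Γ s w' ∧ w.le w')
    (fun u w' => ∀ v x y : Fin n, w.2 false u v = true → Γ.Forces (u, v) (x, y) →
      w'.2 false x y = true)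
    (fun _ _ _ hle h v x y h1 h2 => hle.2.2 _ _ (h v x y h1 h2)) (fun u w₁ hw₁ => ?_)
    ⟨hw, w.le_refl⟩
  · exact ⟨h.1.1, h.2.1, h.2.2⟩
  refine eval_forAll_mono ChromState.le ChromState.le_refl ChromState.le_trans
    (fun w' => ChromState.Sound Γ s w' ∧ w.le w')
    (fun v w' => ∀ x y : Fin n, w.2 false u v = true → Γ.Forces (u, v) (x, y) →
      w'.2 false x y = true)
    (fun _ _ _ hle h x y h1 h2 => hle.2.2 _ _ (h x y h1 h2)) (fun v w₂ hw₂ => ?_) hw₁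
  refine eval_forAll_mono ChromState.le ChromState.le_refl ChromState.le_trans
    (fun w' => ChromState.Sound Γ s w' ∧ w.le w')
    (fun x w' => ∀ y : Fin n, w.2 false u v = true → Γ.Forces (u, v) (x, y) →
      w'.2 false x y = true)
    (fun _ _ _ hle h y h1 h2 => hle.2.2 _ _ (h y h1 h2)) (fun x w₃ hw₃ => ?_) hw₂
  refine eval_forAll_mono ChromState.le ChromState.le_refl ChromState.le_trans
    (fun w' => ChromState.Sound Γ s w' ∧ w.le w')
    (fun y w' => w.2 false u v = true → Γ.Forces (u, v) (x, y) → w'.2 false x y = true)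
    (fun _ _ _ hle h h1 h2 => hle.2.2 _ _ (h h1 h2)) (fun y w₄ hw₄ => ?_) hw₃
  obtain ⟨h1, h2⟩ := eval_chromStep (Γ := Γ) u v x y
    (Function.update (Function.update (Function.update (Function.update e 4 u) 5 v) 6 x) 7 y)
    (by simp [Function.update]) (by simp [Function.update]) (by simp [Function.update])
    (by simp [Function.update]) w₄ hw₄.1.1
  refine ⟨⟨⟨h1.1.trans hw₄.1.1, fun q hq => ?_⟩, ChromState.le_trans _ _ _ hw₄.2 h1⟩, h1,
    fun g1 g2 => (h2 _ _).2 (Or.inr ⟨rfl, rfl, hw₄.2.2.2 _ _ g1, g2⟩)⟩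
  rcases (h2 _ _).1 hq with hq | ⟨hx, hy, g1, g2⟩
  · exact hw₄.1.2 q hq
  · obtain rfl : q = (x, y) := Prod.ext (Fin.ext hx) (Fin.ext hy)
    exact (hw₄.1.2 (u, v) g1).tail g2

/-- After `k` rounds, all arcs at distance at most `k` from `s` are marked. The variables `2` and
`3` serve only to repeat the round `n * n` times, as often as there are pairs of vertices. -/
theorem eval_chromRounds (s : Fin n × Fin n) (e : Fin 8 → ℕ) (w : ChromState)
    (hw : w.Sound Γ s) (hs : w.2 false s.1 s.2 = true) :
    ((LoopProg.forAll 2 (.forAll 3 chromRound)).eval n e w).2 true = matrixOf n Γ.Adj ∧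
    ((LoopProg.forAll 2 (.forAll 3 chromRound)).eval n e w).1.1 = w.1.1 ∧
    ∀ q : Fin n × Fin n,
      ((LoopProg.forAll 2 (.forAll 3 chromRound)).eval n e w).2 false q.1 q.2 = true ↔
      Relation.ReflTransGen Γ.Forces s q := by
  let P : ℕ → ChromState → Prop := fun k w' => w'.Sound Γ s ∧ w'.1.1 = w.1.1 ∧
    ∀ q : Fin n × Fin n, (∃ p : (SimpleGraph.fromRel Γ.Forces).Walk q s, p.length ≤ k) →
      w'.2 false q.1 q.2 = true
  have hround : ∀ k e w', P k w' → P (k + 1) (chromRound.eval n e w') := by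
    rintro k e w' ⟨h1, h2, h3⟩
    obtain ⟨g1, g2, g3⟩ := eval_chromRound s e w' h1
    refine ⟨g1, g2.2.1.trans h2, ?_⟩
    rintro q ⟨p, hp⟩
    cases p with
    | nil => exact g2.2.2 _ _ (h3 s ⟨.nil, Nat.zero_le _⟩)
    | @cons _ m _ hadj p =>
      have hm := h3 m ⟨p, by simpa using hp⟩
      exact g3 _ _ _ _ hm (hadj.2.elim SimpleGraph.Forces.symm id)
  have h0 : P 0 w := by
    refine ⟨hw, rfl, ?_⟩
    rintro q ⟨p, hp⟩
    obtain rfl := SimpleGraph.Walk.eq_of_length_eq_zero (Nat.le_zero.1 hp)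
    exact hs
  have h := eval_forAll_induction (n := n) (x := 2) (p := .forAll 3 chromRound) (e := e)
    -- After `c` outer and `d` further inner iterations, `c * n + d` rounds have been executed.
    (w := w) (fun c => P (c * n)) (by simpa using h0) (fun c _ w' hw' => by
      have := eval_forAll_induction (n := n) (x := 3) (p := chromRound)
        (e := Function.update e 2 c) (w := w') (fun d => P (c * n + d)) hw'
        (fun d _ w'' hw'' => hround _ _ _ hw'')
      rw [Nat.succ_mul]
      exact this)
  refine ⟨h.1.1, h.2.1, fun q => ⟨h.1.2 q, fun hq => h.2.2 q ?_⟩⟩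
  simpa using SimpleGraph.exists_walk_of_reflTransGen_forces hq

theorem eval_chromReset (e : Fin 8 → ℕ) (w : ChromState) :
    (chromReset.eval n e w).2 true = w.2 true ∧ (chromReset.eval n e w).1.1 = w.1.1 ∧
    ∀ u v : Fin n, (chromReset.eval n e w).2 false u v = false := by
  have hmono := fun (w w' : ChromState) (h : w'.le w) (u v : Fin n) (h' : w.2 false u v = false) =>
    Bool.eq_false_of_not_eq_true fun hw' => Bool.eq_false_iff.1 h' (h.2.2 u v hw')
  have h := eval_forAll_mono (n := n) (x := (4 : Fin 8))
    (p := .forAll 5 <| access false 4 5 fun (s : Bool × Bool) _ => (s, false)) (e := e) (w := w)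
    -- The order is reversed, since resetting only removes marks.
    (fun w w' => ChromState.le w' w) ChromState.le_refl
    (fun w₁ w₂ w₃ h h' => ChromState.le_trans w₃ w₂ w₁ h' h) (fun _ => True)
    (fun u w' => ∀ v : Fin n, w'.2 false u v = false)
    (fun u w w' hle h v => hmono w w' hle u v (h v)) (fun u w₁ _ => ?_) trivial
  · exact ⟨h.2.1.1.symm, h.2.1.2.1.symm, h.2.2⟩
  refine eval_forAll_mono (fun w w' => ChromState.le w' w) ChromState.le_refl
    (fun w₁ w₂ w₃ h h' => ChromState.le_trans w₃ w₂ w₁ h' h) (fun _ => True)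
    (fun v w' => w'.2 false u v = false) (fun v w w' hle h => hmono w w' hle u v h)
    (fun v w₂ _ => ?_) trivial
  have h4 : Function.update (Function.update e 4 u.1) 5 v.1 4 = u := by simp [Function.update]
  have h5 : Function.update (Function.update e 4 u.1) 5 v.1 5 = v := by simp [Function.update]
  simp only [eval, h4, h5]
  refine ⟨trivial, ⟨by simp, rfl, fun i j => ?_⟩, by simp⟩
  by_cases hi : i = u
  · subst hi
    by_cases hj : j = v
    · subst hj
      simp
    · simp [hj]
  · simp [hi]

/-- The reset discards the marks of earlier starting arcs, so the marks spread from `(a, b)` alone.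
The check is executed for nonadjacent pairs as well; the final test of adjacency makes it vacuous
for them. -/
theorem eval_chromCheck (a b : Fin n) (e : Fin 8 → ℕ) (h0 : e 0 = a) (h1 : e 1 = b)
    (w : ChromState) (hw : w.2 true = matrixOf n Γ.Adj) :
    (chromCheck.eval n e w).2 true = matrixOf n Γ.Adj ∧
    ((chromCheck.eval n e w).1.1 = true ↔ w.1.1 = true ∧
      (Γ.Adj a b → ¬ Relation.ReflTransGen Γ.Forces (a, b) (b, a))) := by
  obtain ⟨g1, g2, g3⟩ := eval_chromReset (n := n) e w
  obtain ⟨w₁, hw₁⟩ : ∃ w₁, w₁ = chromReset.eval n e w := ⟨_, rfl⟩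
  obtain ⟨w₂, hw₂⟩ : ∃ w₂, w₂ = (access false 0 1 fun s _ => (s, true)).eval n e w₁ := ⟨_, rfl⟩
  rw [← hw₁] at g1 g2 g3
  have hmark : ∀ q : Fin n × Fin n, w₂.2 false q.1 q.2 = true ↔ q = (a, b) := by
    rintro ⟨x, y⟩
    simp only [hw₂, eval, h0, h1, Function.update_self]
    by_cases hx : x = a
    · subst hx
      by_cases hy : y = b
      · subst hy
        simp
      · have hy' : y.1 ≠ b.1 := fun h => hy (Fin.ext h)
        simp [hy, hy', g3]
    · have hx' : x.1 ≠ a.1 := fun h => hx (Fin.ext h)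
      simp [hx, hx', g3]
  have hsound : ChromState.Sound Γ (a, b) w₂ := by
    refine ⟨?_, fun q hq => ?_⟩
    · rw [← hw, ← g1]
      simp [hw₂, eval]
    · rw [(hmark q).1 hq]
  obtain ⟨k1, k2, k3⟩ := eval_chromRounds (a, b) e w₂ hsound ((hmark _).2 rfl)
  have hans : w₂.1.1 = w.1.1 := by
    rw [← g2, hw₂]
    rfl
  rw [hans] at k2
  have hev : chromCheck.eval n e w = ((w.1.1 && !(((LoopProg.forAll 2
      (.forAll 3 chromRound)).eval n e w₂).2 false b a && matrixOf n Γ.Adj a b),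
      ((LoopProg.forAll 2 (.forAll 3 chromRound)).eval n e w₂).2 false b a),
      ((LoopProg.forAll 2 (.forAll 3 chromRound)).eval n e w₂).2) := by
    rw [← k1, ← k2, hw₂, hw₁]
    simp only [chromCheck, eval_test, h0, h1, eval]
  rw [hev]
  refine ⟨k1, ?_⟩
  have := k3 (b, a)
  simp only at this
  rw [← this, ← matrixOf_coe (r := Γ.Adj)]
  simp only [Bool.and_eq_true, Bool.not_eq_true', Bool.and_eq_false_iff, Bool.not_eq_true]
  refine and_congr_right fun _ => ?_
  rw [or_comm, ← Bool.not_eq_true, imp_iff_not_or]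

theorem eval_chromProg (e : Fin 8 → ℕ) (w : ChromState) (hw : w.2 true = matrixOf n Γ.Adj) :
    (chromProg.eval n e w).1.1 = true ↔ w.1.1 = true ∧
      ∀ a b, Γ.Adj a b → ¬ Relation.ReflTransGen Γ.Forces (a, b) (b, a) := by
  refine (eval_forAll_and Prod.fst (fun w => w.2 true = matrixOf n Γ.Adj) _
    (fun a w hw => ?_) hw).2
  refine eval_forAll_and Prod.fst (fun w => w.2 true = matrixOf n Γ.Adj) _ (fun b w hw => ?_) hw
  exact eval_chromCheck a b _ (by simp [Function.update]) (by simp [Function.update]) w hw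

end LoopProg

theorem chromInvar_solvableInPolyTime : SolvableInPolyTime graphEncoding ChromInvar := by
  refine solvableInPolyTime_of_loopProg (fun a => a.1) (fun a => matrixOf a.1 a.2.Adj)
    (fun a => encodeAdj_eq_encodeMatrix _ _) true LoopProg.chromProg ?_ (true, true) Prod.fst
    fun a => ?_
  · simp [LoopProg.chromProg, LoopProg.chromCheck, LoopProg.chromReset, LoopProg.chromRound,
      LoopProg.chromStep, LoopProg.test, LoopProg.Scoped]
  · rw [chromInvar_iff, LoopProg.eval_chromProg (Γ := a.2) _ _ rfl]
    simp

theorem mainTheorem6 :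
    SolvableInPolyTime graphEncoding ChromInvar ∧
      SolvableInPolyTime orientedGraphEncoding OChromInvar := by
  exact ⟨chromInvar_solvableInPolyTime, oChromInvar_solvableInPolyTime⟩
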